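/- Let $\mathbb H$ be the quaternions with polar coordinates $\mathfrak q=(r\cos\theta,\ r\sin\theta\sin\phi\cos\psi,\ r\sin\theta\sin\phi\sin\psi,\ r\sin\theta\cos\phi)$, $r\ge 0$, $\theta,\psi\in[0,2\pi)$, $\phi\in[0,\pi]$, and put $$d\zeta=\tfrac1{4\pi^2}\,e^{-r^2}\,r\sin\phi\,dr\,d\theta\,d\phi\,d\psi,\qquad d\mu=e^{r^2}d\zeta=\tfrac1{4\pi^2}\,r\sin\phi\,dr\,d\theta\,d\phi\,d\psi .$$ Let $\mathfrak H^B_r$ be the Bargmann space of left slice regular functions, i.e. the right quaternionic space of those elements of $L^2(\mathbb H,d\zeta;\mathbb H)$ that have a representative $f$ with $(\partial_x+I\partial_y)f(x+Iy)=0$ for every imaginary unit $I$, with scalar product $\langle f|g\rangle=\int\overline f\,g\,d\zeta$ and orthonormal basis $\Phi_n(\mathfrak q)=\mathfrak q^n/\sqrt{n!}$, $n\ge0$. Left multiplication is $\mathfrak q\cdot f=\sum_n\Phi_n\,\mathfrak q\,\langle\Phi_n|f\rangle$. Let $\mathsf a=\sum_n\sqrt{n+1}\,|\Phi_n\rangle\langle\Phi_{n+1}|$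 and $\mathsf a^\dagger=\sum_n\sqrt{n+1}\,|\Phi_{n+1}\rangle\langle\Phi_n|$ on their natural domains, and $$D(\mathfrak q)=e^{\mathfrak q\cdot\mathsf a^\dagger-\overline{\mathfrak q}\cdot\mathsf a},\qquad S(\mathfrak p)=e^{\frac12(\mathfrak p\cdot(\mathsf a^\dagger)^2-\overline{\mathfrak p}\cdot\mathsf a^2)},$$ where $e^A$ is the time-one operator of the strongly continuous one-parameter group of bounded right-linear operators generated by the closure of $A$. Let $\eta_{\mathfrak q}=e^{-|\mathfrak q|^2/2}\sum_n\Phi_n\,\mathfrak q^n/\sqrt{n!}$ be the canonical coherent states and $\eta^{\mathfrak p}_{\mathfrak q}=S(\mathfrak p)D(\mathfrak q)\Phi_0$ the squeezed states. Then for all $\mathfrak p,\mathfrak q\in\mathbb H$ the exponentials $D(\mathfrak q)$ and $S(\mathfrak p)$ exist and are unitary on $\mathfrak H^B_r$, and $\eta^{\mathfrak p}_{\mathfrak q}=S(\mathfrak p)\eta_{\mathfrak q}$. The squeezed states are normalized, $$\langle\eta^{\mathfrak p}_{\mathfrak q}|\eta^{\mathfrak p}_{\mathfrak q}\rangle=1,$$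 and for every $\mathfrak p\in\mathbb H$ they satisfy the resolution of the identity $$\int_{\mathbb H}|\eta^{\mathfrak p}_{\mathfrak q}\rangle\langle\eta^{\mathfrak p}_{\mathfrak q}|\,d\mu(\mathfrak q)=I_{\mathfrak H^B_r}$$ in the weak sense: for all $f,g\in\mathfrak H^B_r$ the function $\mathfrak q\mapsto\langle f|\eta^{\mathfrak p}_{\mathfrak q}\rangle\langle\eta^{\mathfrak p}_{\mathfrak q}|g\rangle$ is $\mu$-integrable with integral $\langle f|g\rangle$. -/

import Mathlib

open MeasureTheory
open scoped Quaternion RightActions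

noncomputable section

namespace QBargmann

/-! ### Measures on the quaternions in polar coordinates -/

instance instMeasurableSpaceQuaternion : MeasurableSpace ℍ := borel ℍ

instance instBorelSpaceQuaternion : BorelSpace ℍ := ⟨rfl⟩

/-- Polar coordinates `(r, θ, φ, ψ)` on the quaternions. -/
def polar (x : ℝ × ℝ × ℝ × ℝ) : ℍ :=
  ⟨x.1 * Real.cos x.2.1,
   x.1 * Real.sin x.2.1 * Real.sin x.2.2.1 * Real.cos x.2.2.2,
   x.1 * Real.sin x.2.1 * Real.sin x.2.2.1 * Real.sin x.2.2.2,
   x.1 * Real.sin x.2.1 * Real.cos x.2.2.1⟩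

/-- The coordinate domain: `r ∈ [0, ∞)`, `θ ∈ [0, 2π)`, `φ ∈ [0, π]`, `ψ ∈ [0, 2π)`. -/
def polarBox : Set (ℝ × ℝ × ℝ × ℝ) :=
  Set.Ici 0 ×ˢ (Set.Ico 0 (2 * Real.pi) ×ˢ (Set.Icc 0 Real.pi ×ˢ Set.Ico 0 (2 * Real.pi)))

/-- The measure `(1 / 4π²) w(r) sin φ dr dθ dφ dψ` on the quaternions. -/
def polarMeasure (w : ℝ → ℝ) : Measure ℍ :=
  ((volume.restrict polarBox).withDensity fun x =>
    ENNReal.ofReal (w x.1 * Real.sin x.2.2.1 / (4 * Real.pi ^ 2))).map polar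

/-- The Gaussian probability measure `(1 / 4π²) e^{-r²} r sin φ dr dθ dφ dψ`. -/
def gaussMeasure : Measure ℍ := polarMeasure fun r => r * Real.exp (-r ^ 2)

/-- The measure `(1 / 4π²) r sin φ dr dθ dφ dψ`, that is, `e^{|q|²}` times the Gaussian one. -/
def flatMeasure : Measure ℍ := polarMeasure fun r => r

/-! ### The right quaternionic Hilbert space `L²` and the Bargmann space -/

/-- The right quaternionic Hilbert space of square integrable quaternion-valued functions;
the right multiplication by `q` is the action of `MulOpposite.op q`, written `f <• q`. -/
abbrev L2 : Type := Lp ℍ 2 gaussMeasure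

/-- `f` is left slice regular on the quaternions: for every imaginary unit `I`, the restriction
`(x, y) ↦ f (x + I y)` is real differentiable and satisfies `(∂/∂x + I ∂/∂y) f = 0`. -/
def IsSliceRegular (f : ℍ → ℍ) : Prop :=
  ∀ I : ℍ, I * I = -1 →
    Differentiable ℝ (fun z : ℝ × ℝ => f ((z.1 : ℍ) + z.2 • I)) ∧
    ∀ z : ℝ × ℝ,
      fderiv ℝ (fun z : ℝ × ℝ => f ((z.1 : ℍ) + z.2 • I)) z (1, 0) +
        I * fderiv ℝ (fun z : ℝ × ℝ => f ((z.1 : ℍ) + z.2 • I)) z (0, 1) = 0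

theorem IsSliceRegular.add {f g : ℍ → ℍ} (hf : IsSliceRegular f) (hg : IsSliceRegular g) :
    IsSliceRegular (fun x => f x + g x) := by
  intro I hI
  obtain ⟨hf1, hf2⟩ := hf I hI
  obtain ⟨hg1, hg2⟩ := hg I hI
  refine ⟨hf1.add hg1, fun z => ?_⟩
  have h := fderiv_fun_add (hf1 z) (hg1 z)
  rw [h]
  simp only [_root_.add_apply, mul_add]
  rw [add_add_add_comm, hf2, hg2, add_zero]

theorem IsSliceRegular.mul_const {f : ℍ → ℍ} (hf : IsSliceRegular f) (q : ℍ) :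
    IsSliceRegular (fun x => f x * q) := by
  intro I hI
  obtain ⟨hf1, hf2⟩ := hf I hI
  refine ⟨hf1.mul_const q, fun z => ?_⟩
  have h := fderiv_mul_const' (hf1 z) q
  rw [h]
  simp only [_root_.smul_apply, MulOpposite.smul_eq_mul_unop, MulOpposite.unop_op]
  rw [← mul_assoc, ← add_mul, hf2, zero_mul]

theorem isSliceRegular_zero : IsSliceRegular (fun _ => 0) := by
  intro I _
  exact ⟨differentiable_const 0, fun z => by simp⟩

theorem isSliceRegular_pow (n : ℕ) : IsSliceRegular (fun x => x ^ n) := by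
  intro I hI
  have hlin : ∀ z : ℝ × ℝ, HasFDerivAt (fun z : ℝ × ℝ => ((z.1 : ℍ) + z.2 • I))
      ((ContinuousLinearMap.fst ℝ ℝ ℝ).smulRight (1 : ℍ) +
        (ContinuousLinearMap.snd ℝ ℝ ℝ).smulRight I) z := by
    intro z
    have h := ((ContinuousLinearMap.fst ℝ ℝ ℝ).smulRight (1 : ℍ) +
        (ContinuousLinearMap.snd ℝ ℝ ℝ).smulRight I).hasFDerivAt (x := z)
    refine h.congr_of_eventuallyEq (Filter.Eventually.of_forall fun w => ?_)
    have hw : (w.1 : ℍ) = w.1 • (1 : ℍ) := by ext <;> simp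
    simp [hw]
  induction n with
  | zero => exact ⟨by simp, fun z => by simp⟩
  | succ n ih =>
    obtain ⟨h1, h2⟩ := ih
    simp only [pow_succ]
    refine ⟨h1.mul fun z => (hlin z).differentiableAt, fun z => ?_⟩
    have h := fderiv_mul' (h1 z) (hlin z).differentiableAt
    have hc : Commute I (((z.1 : ℍ) + z.2 • I) ^ n) := by
      refine Commute.pow_right (Commute.add_right ?_ ?_) n
      · exact (Quaternion.coe_commutes z.1 I).symm
      · exact (Commute.refl I).smul_right z.2
    rw [(hlin z).fderiv] at h
    erw [h]
    simp only [_root_.add_apply, _root_.smul_apply, MulOpposite.smul_eq_mul_unop,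
      MulOpposite.unop_op, ContinuousLinearMap.smulRight_apply, ContinuousLinearMap.coe_fst',
      ContinuousLinearMap.coe_snd', smul_eq_mul, one_smul, zero_smul, add_zero, zero_add, mul_one]
    have h4 : I * (((z.1 : ℍ) + z.2 • I) ^ n * I) = - ((z.1 : ℍ) + z.2 • I) ^ n := by
      rw [← mul_assoc, hc.eq, mul_assoc, hI, mul_neg_one]
    have h3 := congrArg (fun w => w * ((z.1 : ℍ) + z.2 • I)) (h2 z)
    simp only [zero_mul, add_mul _ _ ((z.1 : ℍ) + z.2 • I), mul_assoc] at h3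
    rw [mul_add I, h4, add_add_add_comm, add_neg_cancel, zero_add]
    exact h3

theorem measurable_polar : Measurable polar := by
  have h : Continuous polar := by
    have e : polar = fun x => (Quaternion.linearIsometryEquivTuple).symm
        (WithLp.toLp 2 ![x.1 * Real.cos x.2.1,
          x.1 * Real.sin x.2.1 * Real.sin x.2.2.1 * Real.cos x.2.2.2,
          x.1 * Real.sin x.2.1 * Real.sin x.2.2.1 * Real.sin x.2.2.2,
          x.1 * Real.sin x.2.1 * Real.cos x.2.2.1]) := by
      funext x
      rw [Quaternion.linearIsometryEquivTuple_symm_apply]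
      rfl
    rw [e]
    fun_prop
  exact h.measurable

theorem norm_polar (x : ℝ × ℝ × ℝ × ℝ) : ‖polar x‖ = |x.1| := by
  have h : ‖polar x‖ * ‖polar x‖ = x.1 ^ 2 := by
    rw [← Quaternion.normSq_eq_norm_mul_self, Quaternion.normSq_def']
    simp only [polar]
    linear_combination x.1 ^ 2 * (Real.sin_sq_add_cos_sq x.2.1) +
      x.1 ^ 2 * Real.sin x.2.1 ^ 2 * (Real.sin_sq_add_cos_sq x.2.2.1) +
      x.1 ^ 2 * Real.sin x.2.1 ^ 2 * Real.sin x.2.2.1 ^ 2 * (Real.sin_sq_add_cos_sq x.2.2.2)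
  rw [← abs_of_nonneg (norm_nonneg (polar x)), ← sq_eq_sq_iff_abs_eq_abs, ← h, sq]

theorem memLp_pow (n : ℕ) : MemLp (fun x : ℍ => x ^ n) 2 gaussMeasure := by
  refine ⟨(continuous_pow n).aestronglyMeasurable, ?_⟩
  rw [eLpNorm_lt_top_iff_lintegral_rpow_enorm_lt_top (by simp) (by simp)]
  have hm : Measurable fun x : ℍ => ‖x ^ n‖ₑ ^ (2 : ENNReal).toReal :=
    ((continuous_pow n).enorm.measurable).pow_const _
  have hd : Measurable fun x : ℝ × ℝ × ℝ × ℝ =>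
      ENNReal.ofReal (x.1 * Real.exp (-x.1 ^ 2) * Real.sin x.2.2.1 / (4 * Real.pi ^ 2)) := by
    fun_prop
  rw [gaussMeasure, polarMeasure, lintegral_map hm measurable_polar,
    lintegral_withDensity_eq_lintegral_mul _ hd (g := fun x => ‖polar x ^ n‖ₑ ^ (2 : ENNReal).toReal)
      (hm.comp measurable_polar)]
  have hbox : (volume : Measure (ℝ × ℝ × ℝ × ℝ)).restrict polarBox =
      (volume.restrict (Set.Ici 0)).prod ((volume.restrict (Set.Ico 0 (2 * Real.pi))).prod
        ((volume.restrict (Set.Icc 0 Real.pi)).prod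
          (volume.restrict (Set.Ico 0 (2 * Real.pi))))) := by
    rw [Measure.prod_restrict, Measure.prod_restrict, Measure.prod_restrict]
    rfl
  have hr : Integrable (fun r : ℝ => r ^ (2 * n + 1) * Real.exp (-r ^ 2))
      (volume.restrict (Set.Ici 0)) := by
    have h := integrable_rpow_mul_exp_neg_mul_sq (b := 1) one_pos (s := ((2 * n + 1 : ℕ) : ℝ))
      (lt_of_lt_of_le (by norm_num) (Nat.cast_nonneg _))
    refine (h.congr (Filter.Eventually.of_forall fun r => ?_)).integrableOn
    simp only [Real.rpow_natCast, neg_mul, one_mul]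
  have hall := hr.mul_prod ((integrable_const (1 : ℝ)).mul_prod
    ((integrable_const (μ := volume.restrict (Set.Icc 0 Real.pi)) (1 / (4 * Real.pi ^ 2) : ℝ)).mul_prod
    (integrable_const (μ := volume.restrict (Set.Ico 0 (2 * Real.pi))) (1 : ℝ)))
    (μ := volume.restrict (Set.Ico 0 (2 * Real.pi))))
  rw [← hbox] at hall
  refine lt_of_le_of_lt (setLIntegral_mono' ?_ ?_) hall.lintegral_lt_top
  · exact measurableSet_Ici.prod (measurableSet_Ico.prod (measurableSet_Icc.prod measurableSet_Ico))
  rintro x ⟨hx1, -, -, -⟩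
  have hx : 0 ≤ x.1 := hx1
  have h2 : (‖polar x ^ n‖ₑ ^ (2 : ENNReal).toReal) = ENNReal.ofReal (x.1 ^ (2 * n)) := by
    rw [← ofReal_norm, norm_pow, norm_polar, abs_of_nonneg hx, ENNReal.toReal_ofNat,
      ENNReal.ofReal_rpow_of_nonneg (by positivity) (by norm_num)]
    congr 1
    rw [Real.rpow_ofNat, ← pow_mul, mul_comm]
  simp only [Pi.mul_apply]
  rw [h2, ← ENNReal.ofReal_mul' (by positivity)]
  refine ENNReal.ofReal_le_ofReal ?_
  have h3 : 0 ≤ x.1 * Real.exp (-x.1 ^ 2) * x.1 ^ (2 * n) / (4 * Real.pi ^ 2) := by positivity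
  calc _ = x.1 * Real.exp (-x.1 ^ 2) * x.1 ^ (2 * n) / (4 * Real.pi ^ 2) * Real.sin x.2.2.1 := by
        ring
    _ ≤ x.1 * Real.exp (-x.1 ^ 2) * x.1 ^ (2 * n) / (4 * Real.pi ^ 2) * 1 :=
        mul_le_mul_of_nonneg_left (Real.sin_le_one _) h3
    _ = _ := by ring

/-- The Bargmann space of left regular functions: the square integrable functions that have a
left slice regular representative. -/
def bargmannSpace : Submodule ℍᵐᵒᵖ L2 where
  carrier := {F | ∃ f : ℍ → ℍ, IsSliceRegular f ∧ F =ᵐ[gaussMeasure] f}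
  add_mem' := by
    rintro F G ⟨f, hf, hF⟩ ⟨g, hg, hG⟩
    refine ⟨_, hf.add hg, ?_⟩
    filter_upwards [Lp.coeFn_add F G, hF, hG] with x h1 h2 h3
    rw [h1, Pi.add_apply, h2, h3]
  zero_mem' := ⟨_, isSliceRegular_zero, Lp.coeFn_zero ℍ 2 gaussMeasure⟩
  smul_mem' := by
    rintro q F ⟨f, hf, hF⟩
    refine ⟨_, hf.mul_const q.unop, ?_⟩
    filter_upwards [Lp.coeFn_smul q F, hF] with x h1 h2
    rw [h1, Pi.smul_apply, h2, MulOpposite.smul_eq_mul_unop]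

/-- The Bargmann space as a type. -/
abbrev HB : Type := bargmannSpace

instance instNormedAddCommGroupHB : NormedAddCommGroup HB := inferInstance

instance instModuleHB : Module ℍᵐᵒᵖ HB := inferInstance

instance instNormedSpaceHB : NormedSpace ℝ HB := bargmannSpace.normedSpace

instance instContinuousConstSMulHB : ContinuousConstSMul ℍᵐᵒᵖ HB :=
  ContinuousSMul.continuousConstSMul

instance instSMulCommClassHB : SMulCommClass ℍᵐᵒᵖ ℝ HB where
  smul_comm q r f := by
    rw [← algebraMap_smul ℍᵐᵒᵖ r f, ← algebraMap_smul ℍᵐᵒᵖ r (q • f), smul_smul, smul_smul,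
      Algebra.commutes]

/-- The quaternionic scalar product `⟨f | g⟩ = ∫ conj(f) g dζ`. -/
def qinner (f g : HB) : ℍ := ∫ x, star ((f : L2) x) * (g : L2) x ∂gaussMeasure

theorem integrable_qinner (f g : HB) :
    Integrable (fun x => star ((f : L2) x) * (g : L2) x) gaussMeasure :=
  MemLp.integrable_mul (Lp.memLp (f : L2)).star (Lp.memLp (g : L2))

theorem qinner_add (f g h : HB) : qinner f (g + h) = qinner f g + qinner f h := by
  rw [qinner, qinner, qinner, ← integral_add (integrable_qinner f g) (integrable_qinner f h)]
  refine integral_congr_ae ?_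
  filter_upwards [Lp.coeFn_add (g : L2) (h : L2)] with x h1
  rw [Submodule.coe_add, h1, Pi.add_apply, mul_add]

theorem qinner_smul (f g : HB) (q : ℍᵐᵒᵖ) : qinner f (q • g) = qinner f g * q.unop := by
  rw [qinner, qinner, ← integral_mul_const_of_integrable (integrable_qinner f g)]
  refine integral_congr_ae ?_
  filter_upwards [Lp.coeFn_smul q (g : L2)] with x h1
  rw [Submodule.coe_smul, h1, Pi.smul_apply, MulOpposite.smul_eq_mul_unop, mul_assoc]

theorem qinner_zero (f : HB) : qinner f 0 = 0 := by
  have h := qinner_smul f 0 0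
  simpa using h

/-- The orthonormal basis vectors `Φₙ(q) = qⁿ / √(n!)`. -/
def Φ (n : ℕ) : HB :=
  (⟨(memLp_pow n).toLp _, _, isSliceRegular_pow n, (memLp_pow n).coeFn_toLp⟩ : HB) <•
    ((1 / √(n.factorial : ℝ) : ℝ) : ℍ)

/-! ### Unbounded operators -/

/-- The right linear operator `∑ₙ |eₙ⟩ cₙ ⟨dₙ|` on its natural domain, the vectors `f` for which
`∑ₙ eₙ cₙ ⟨dₙ | f⟩` converges unconditionally. -/
def ketBraSum (e : ℕ → HB) (c : ℕ → ℍ) (d : ℕ → HB) : HB →ₗ.[ℍᵐᵒᵖ] HB where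
  domain :=
    { carrier := {f | Summable fun n => e n <• (c n * qinner (d n) f)}
      add_mem' := by
        intro f g hf hg
        simp only [Set.mem_ofPred_eq, qinner_add, mul_add, MulOpposite.op_add, add_smul] at *
        exact hf.add hg
      zero_mem' := by
        simp only [Set.mem_ofPred_eq, qinner_zero, mul_zero, MulOpposite.op_zero, zero_smul]
        exact summable_zero
      smul_mem' := by
        intro q f hf
        simp only [Set.mem_ofPred_eq, qinner_smul] at *
        refine (hf.const_smul q).congr fun n => ?_
        rw [smul_smul, ← mul_assoc, MulOpposite.op_mul _ q.unop, MulOpposite.op_unop] }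
  toFun :=
    { toFun := fun f => ∑' n, e n <• (c n * qinner (d n) (f : HB))
      map_add' := by
        rintro ⟨f, hf⟩ ⟨g, hg⟩
        simp only [AddMemClass.mk_add_mk, qinner_add, mul_add, MulOpposite.op_add, add_smul]
        exact Summable.tsum_add hf hg
      map_smul' := by
        rintro q ⟨f, hf⟩
        simp only [SetLike.mk_smul_mk, qinner_smul, RingHom.id_apply]
        rw [← Summable.tsum_const_smul q hf]
        refine tsum_congr fun n => ?_
        rw [smul_smul, ← mul_assoc, MulOpposite.op_mul _ q.unop, MulOpposite.op_unop] }

/-- The product `B A` of operators, on its natural domain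
`{f ∈ dom A | A f ∈ dom B}`. -/
def opMul (B A : HB →ₗ.[ℍᵐᵒᵖ] HB) : HB →ₗ.[ℍᵐᵒᵖ] HB where
  domain := (B.domain.comap A.toFun).map A.domain.subtype
  toFun :=
    { toFun := fun f => B ⟨A ⟨f, by
          obtain ⟨f, y, hy, rfl⟩ := f; exact y.2⟩, by
          obtain ⟨f, y, hy, rfl⟩ := f; exact hy⟩
      map_add' := by
        rintro ⟨-, y, hy, rfl⟩ ⟨-, z, hz, rfl⟩
        rw [← B.map_add]
        congr 1
        exact Subtype.ext (A.map_add y z)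
      map_smul' := by
        rintro q ⟨-, y, hy, rfl⟩
        rw [RingHom.id_apply, ← B.map_smul]
        congr 1
        exact Subtype.ext (A.map_smul q y) }

/-- Left multiplication by `q` with respect to the basis: `q · f = ∑ₙ Φₙ q ⟨Φₙ | f⟩`. -/
def leftMul (q : ℍ) : HB →ₗ.[ℍᵐᵒᵖ] HB := ketBraSum Φ (fun _ => q) Φ

/-- The annihilation operator `a = ∑ₙ √(n+1) |Φₙ⟩⟨Φₙ₊₁|`. -/
def annih : HB →ₗ.[ℍᵐᵒᵖ] HB := ketBraSum Φ (fun n => (√(n + 1 : ℝ) : ℍ)) (fun n => Φ (n + 1))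

/-- The creation operator `a† = ∑ₙ √(n+1) |Φₙ₊₁⟩⟨Φₙ|`. -/
def creat : HB →ₗ.[ℍᵐᵒᵖ] HB := ketBraSum (fun n => Φ (n + 1)) (fun n => (√(n + 1 : ℝ) : ℍ)) Φ

/-- `S` is the exponential of the densely defined operator `A`: there is a strongly continuous
one-parameter group `U` of bounded right linear operators whose infinitesimal generator is the
closure of `A`, and `S = U 1`. -/
def IsOperatorExp (A : HB →ₗ.[ℍᵐᵒᵖ] HB) (S : HB →L[ℍᵐᵒᵖ] HB) : Prop :=
  ∃ U : ℝ → HB →L[ℍᵐᵒᵖ] HB,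
    U 0 = ContinuousLinearMap.id ℍᵐᵒᵖ HB ∧
    (∀ s t, U (s + t) = (U s).comp (U t)) ∧
    (∀ f, Continuous fun t => U t f) ∧
    (∀ f g, HasDerivAt (fun t => U t f) g 0 ↔ (f, g) ∈ closure (A.graph : Set (HB × HB))) ∧
    U 1 = S

open Classical in
/-- The exponential `e^A` of an operator (the zero operator if there is none). -/
def operatorExp (A : HB →ₗ.[ℍᵐᵒᵖ] HB) : HB →L[ℍᵐᵒᵖ] HB :=
  if h : ∃ S, IsOperatorExp A S then h.choose else 0

/-- A unitary operator of the right quaternionic Hilbert space. -/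
def IsUnitary (S : HB →L[ℍᵐᵒᵖ] HB) : Prop :=
  (∀ f g, qinner (S f) (S g) = qinner f g) ∧ Function.Surjective S

/-! ### Displacement, squeezing and the coherent states -/

/-- `q · a† - q̄ · a`. -/
def displacementExponent (q : ℍ) : HB →ₗ.[ℍᵐᵒᵖ] HB :=
  opMul (leftMul q) creat - opMul (leftMul (star q)) annih

/-- `½ (p · (a†)² - p̄ · a²)`. -/
def squeezeExponent (p : ℍ) : HB →ₗ.[ℍᵐᵒᵖ] HB :=
  (1 / 2 : ℝ) • (opMul (leftMul p) (opMul creat creat) -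
    opMul (leftMul (star p)) (opMul annih annih))

/-- The displacement operator `D(q)`. -/
def displacement (q : ℍ) : HB →L[ℍᵐᵒᵖ] HB := operatorExp (displacementExponent q)

/-- The squeeze operator `S(p)`. -/
def squeeze (p : ℍ) : HB →L[ℍᵐᵒᵖ] HB := operatorExp (squeezeExponent p)

/-- The canonical coherent state `η_q = e^{-|q|²/2} ∑ₙ Φₙ qⁿ / √(n!)`. -/
def coherentState (q : ℍ) : HB :=
  Real.exp (-‖q‖ ^ 2 / 2) • ∑' n : ℕ, Φ n <• ((1 / √(n.factorial : ℝ) : ℝ) • q ^ n)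

/-- The squeezed state `η_q^p = S(p) D(q) Φ₀`. -/
def squeezedState (p q : ℍ) : HB := squeeze p (displacement q (Φ 0))

end QBargmann

end

noncomputable section

namespace QBargmann

open Filter Topology

/-! ### Strong limits of isometric flows -/

section StrongLimit

variable {H : Type*} [NormedAddCommGroup H] [NormedSpace ℝ H]

/-! Coordinates. For fixed `r`, `φ`, `ψ` the angle `θ` runs over a full circle inside the complex
slice of one imaginary unit. On a slice, complex-valued functionals of a left slice regular function
are entire, so Cauchy's formula evaluates its pairing with a power as a Taylor coefficient. These
coefficients are real derivatives along the axis common to all slices, hence do not depend on the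
slice (`integral_slice`, `integral_star_pow_mul`). Thus the `Φ n` are orthonormal, a slice regular
function orthogonal to all of them vanishes, and the Bargmann space is an isometric copy of the
square summable quaternionic sequences (`range_synthesis`, `coords`).

Exponentials. In these coordinates both exponents send `c k` to `α k * p * c k` in place `k + d`,
minus the adjoint, with `d = 1` or `d = 2` and `|α k| ≤ C * (k + 1)`. The truncation to `k < n` is
bounded and skew, so its flow is isometric. Since `α` grows at most linearly, the weighted norm `∑
(k + 1) ^ 4 * ‖c k‖ ^ 2` grows at most exponentially in time, at a rate independent of `n`
(`Coordinates.weight_le`). Duhamel's formula then makes the truncated flows converge strongly. The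
limit is an isometric group, and its generator is the closure of the operator on finite vectors
(`IsFlowApprox.hasDerivAt_limit_iff`), which is also the closure from the natural domain
(`closure_graph_eq`). Solutions of the evolution equation are unique (`orbit_eq_of_hasDerivAt`), so
the exponential does not depend on the chosen group. It is right linear because `p` multiplies
coordinates from the left.

States. The curve of coherent states along the ray of real multiples of `q` solves the evolution
equation of the displacement exponent and starts at the vacuum, whence `displacement_vacuum`.
Pairing with a coherent state is, up to the factor `e^{-|q|²/2}`, evaluation of the power series at
the conjugate of `q`. The two factors turn the flat measure into the Gaussian one, which is
invariant under conjugation, and `resolution_coherentState` follows. Unitarity of the squeeze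
operator carries normalization and resolution over to the squeezed states. -/

/-- The flow `e^{tA}` of a bounded operator `A`. -/
def flow (A : H →L[ℝ] H) (t : ℝ) : H →L[ℝ] H := NormedSpace.exp (t • A)

/-- The graph of the pointwise eventual value of a sequence of operators on a subspace. -/
def eventualGraph (A : ℕ → H →L[ℝ] H) (D : Submodule ℝ H) : Submodule ℝ (H × H) where
  carrier := {x | x.1 ∈ D ∧ ∀ᶠ n in atTop, A n x.1 = x.2}
  add_mem' := by
    rintro x y ⟨hx, hx'⟩ ⟨hy, hy'⟩
    refine ⟨D.add_mem hx hy, ?_⟩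
    filter_upwards [hx', hy'] with n h1 h2
    rw [Prod.fst_add, map_add, h1, h2, Prod.snd_add]
  zero_mem' := ⟨D.zero_mem, Eventually.of_forall fun n => by simp⟩
  smul_mem' := by
    rintro r x ⟨hx, hx'⟩
    refine ⟨D.smul_mem r hx, ?_⟩
    filter_upwards [hx'] with n h1
    rw [Prod.smul_fst, map_smul, h1, Prod.smul_snd]

/-- The bounded operators `A n` have isometric flows which approximate, uniformly for bounded
times, a flow on the dense subspace `D`. -/
structure IsFlowApprox (A : ℕ → H →L[ℝ] H) (D : Submodule ℝ H) : Prop where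
  norm_flow : ∀ n t f, ‖flow (A n) t f‖ = ‖f‖
  dense : Dense (D : Set H)
  eventually_eq : ∀ h ∈ D, ∃ g, ∀ᶠ n in atTop, A n h = g
  flow_mem : ∀ h ∈ D, ∀ᶠ n in atTop, ∀ t, flow (A n) t h ∈ D
  -- The later generators `A m` are tested along the orbit of the `n`-th flow, which is exactly the
  -- integrand in Duhamel's formula.
  defect : ∀ h ∈ D, ∀ T : ℝ, ∃ ε : ℕ → ℝ, Tendsto ε atTop (𝓝 0) ∧
    ∀ᶠ n in atTop, ∀ m ≥ n, ∀ t, |t| ≤ T →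
      ‖A m (flow (A n) t h) - A n (flow (A n) t h)‖ ≤ ε n

theorem flow_zero (A : H →L[ℝ] H) : flow A 0 = 1 := by
  simp [flow]

theorem apply_flow (A : H →L[ℝ] H) (t : ℝ) (f : H) : A (flow A t f) = flow A t (A f) := by
  have h : Commute A (flow A t) := ((Commute.refl A).smul_right t).exp_right
  exact congrArg (fun B : H →L[ℝ] H => B f) h.eq

theorem norm_sub_le_mul_abs {u u' : ℝ → H} {C T : ℝ} (hu : ∀ s, HasDerivAt u (u' s) s)
    (hC : ∀ s, |s| ≤ T → ‖u' s‖ ≤ C) {t : ℝ} (ht : |t| ≤ T) : ‖u t - u 0‖ ≤ C * |t| := by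
  have h := (convex_Icc (-T) T).norm_image_sub_le_of_norm_hasDerivWithin_le (f := u) (x := 0)
    (y := t) (fun s _ => (hu s).hasDerivWithinAt) (fun s hs => hC s (abs_le.2 hs))
    (by have := (abs_nonneg t).trans ht; constructor <;> linarith) (abs_le.1 ht)
  simpa using h

/-- A curve that solves the evolution equation of an isometric group is an orbit of it. -/
theorem orbit_eq_of_hasDerivAt {U : ℝ → H →L[ℝ] H} {G : Set (H × H)} (hU0 : ∀ f, U 0 f = f)
    (hU : ∀ s t f, U (s + t) f = U s (U t f)) (hn : ∀ t f, ‖U t f‖ = ‖f‖)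
    (hc : ∀ f, Continuous fun t => U t f)
    (hG : ∀ x ∈ G, HasDerivAt (fun t => U t x.1) x.2 0) {v v' : ℝ → H}
    (hv : ∀ t, HasDerivAt v (v' t) t) (hmem : ∀ t, (v t, v' t) ∈ G) (t : ℝ) :
    v t = U t (v 0) := by
  -- Pulling the curve back along the group gives a constant: the velocity `v'` cancels against the
  -- generator applied to `v`.
  have hderiv : ∀ t, HasDerivAt (fun s => U (-s) (v s)) 0 t := by
    intro t
    rw [hasDerivAt_iff_tendsto_slope_zero]
    have h1 := (hasDerivAt_iff_tendsto_slope_zero.1 (hv t))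
    have h2 : HasDerivAt (fun s => U (-s) (v t)) (-(v' t)) 0 := by
      have h := hG _ (hmem t)
      rw [← neg_zero] at h
      have h' := h.scomp (0 : ℝ) (hasDerivAt_neg (0 : ℝ))
      rwa [neg_one_smul] at h'
    have h3 := hasDerivAt_iff_tendsto_slope_zero.1 h2
    simp only [zero_add, neg_zero, hU0] at h3
    have h4 : Tendsto (fun s => U (-s) (s⁻¹ • (v (t + s) - v t))) (𝓝[≠] 0) (𝓝 (v' t)) := by
      -- The operator and its argument both move. Isometry makes the error from the argument uniform
      -- in the operator, so strong continuity suffices.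
      have h5 : Tendsto (fun s => U (-s) (s⁻¹ • (v (t + s) - v t) - v' t)) (𝓝[≠] 0) (𝓝 0) := by
        rw [tendsto_zero_iff_norm_tendsto_zero]
        simp only [hn]
        exact tendsto_zero_iff_norm_tendsto_zero.1 (by simpa using h1.sub_const (v' t))
      have h6 : Tendsto (fun s => U (-s) (v' t)) (𝓝[≠] 0) (𝓝 (v' t)) := by
        have h7 := ((hc (v' t)).comp continuous_neg).tendsto 0
        simp only [Function.comp_apply, neg_zero, hU0] at h7
        exact h7.mono_left nhdsWithin_le_nhds
      simpa using h5.add h6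
    have h8 := ((U (-t)).continuous.tendsto _).comp (h4.add h3)
    simp only [add_neg_cancel, map_zero] at h8
    refine h8.congr fun s => ?_
    simp only [Function.comp_apply, map_smul, ← smul_add, map_add, map_sub, ← hU]
    rw [neg_add]
    congr 1
    abel
  have hconst := is_const_of_deriv_eq_zero (fun t => (hderiv t).differentiableAt)
    (fun t => (hderiv t).deriv) t 0
  simp only [neg_zero, hU0] at hconst
  rw [← hconst, ← hU, add_neg_cancel, hU0]

variable [CompleteSpace H]

theorem flow_add (A : H →L[ℝ] H) (s t : ℝ) : flow A (s + t) = flow A s * flow A t := by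
  let : NormedAlgebra ℚ (H →L[ℝ] H) := NormedAlgebra.restrictScalars ℚ ℝ _
  rw [flow, add_smul, NormedSpace.exp_add_of_commute]
  · rfl
  · exact ((Commute.refl A).smul_left s).smul_right t

theorem flow_neg_flow (A : H →L[ℝ] H) (t : ℝ) (f : H) : flow A (-t) (flow A t f) = f := by
  have h := flow_add A (-t) t
  rw [neg_add_cancel, flow_zero] at h
  exact (congrArg (fun B : H →L[ℝ] H => B f) h).symm

theorem hasDerivAt_flow (A : H →L[ℝ] H) (t : ℝ) :
    HasDerivAt (flow A) (flow A t * A) t :=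
  hasDerivAt_exp_smul_const A t

theorem hasDerivAt_flow_apply (A : H →L[ℝ] H) (t : ℝ) (f : H) :
    HasDerivAt (fun s => flow A s f) (flow A t (A f)) t := by
  simpa using (hasDerivAt_flow A t).clm_apply (hasDerivAt_const t f)

/-- Duhamel: the derivative of `flow B (-s) (flow A s h)` is `flow B (-s)` applied to the difference
of the generators on the orbit of `A`, and the flow of `B` does not change norms. -/
theorem norm_flow_sub_flow_le {A B : H →L[ℝ] H} (hB : ∀ t f, ‖flow B t f‖ = ‖f‖) {h : H}
    {ε T : ℝ} (hd : ∀ t, |t| ≤ T → ‖B (flow A t h) - A (flow A t h)‖ ≤ ε) {t : ℝ} (ht : |t| ≤ T) :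
    ‖flow B t h - flow A t h‖ ≤ ε * |t| := by
  have hderiv : ∀ s, HasDerivAt (fun s => flow B (-s) (flow A s h))
      (flow B (-s) (A (flow A s h) - B (flow A s h))) s := by
    intro s
    have h1 : HasDerivAt (fun s => flow B (-s)) (-(flow B (-s) * B)) s := by
      have h := (hasDerivAt_flow B (-s)).scomp s (hasDerivAt_neg s)
      rwa [neg_one_smul] at h
    convert h1.clm_apply (hasDerivAt_flow_apply A s h) using 1
    rw [map_sub, ← apply_flow A]
    simp only [_root_.neg_apply, mul_apply_eq_comp]
    abel
  have h2 := norm_sub_le_mul_abs hderiv (C := ε) (T := T) (fun s hs => by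
    rw [hB, norm_sub_rev]; exact hd s hs) ht
  calc ‖flow B t h - flow A t h‖ = ‖flow B (-t) (flow A t h - flow B t h)‖ := by
        rw [hB, norm_sub_rev]
    _ ≤ _ := by
        rw [map_sub, flow_neg_flow]
        simpa [flow_zero] using h2

/-! ### The limit group and its generator -/

namespace IsFlowApprox

variable {A : ℕ → H →L[ℝ] H} {D : Submodule ℝ H} (hA : IsFlowApprox A D)
include hA

theorem cauchySeq_of_mem {h : H} (hh : h ∈ D) (t : ℝ) :
    CauchySeq fun n => flow (A n) t h := by
  obtain ⟨ε, hε, hev⟩ := hA.defect h hh |t|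
  obtain ⟨N, hN⟩ := eventually_atTop.1 hev
  refine Metric.cauchySeq_iff'.2 fun δ hδ => ?_
  have h0 : Tendsto (fun n => ε n * |t|) atTop (𝓝 0) := by simpa using hε.mul_const |t|
  obtain ⟨M, hM⟩ := eventually_atTop.1 (h0.eventually (gt_mem_nhds hδ))
  refine ⟨max N M, fun n hn => ?_⟩
  rw [dist_eq_norm]
  exact (norm_flow_sub_flow_le (hA.norm_flow n) (hN _ (le_max_left _ _) n hn) le_rfl).trans_lt
    (hM _ (le_max_right _ _))

theorem exists_tendsto (t : ℝ) (f : H) : ∃ g, Tendsto (fun n => flow (A n) t f) atTop (𝓝 g) := by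
  refine cauchySeq_tendsto_of_complete (Metric.cauchySeq_iff'.2 fun δ hδ => ?_)
  obtain ⟨h, hh, hfh⟩ := hA.dense.exists_dist_lt f (by positivity : 0 < δ / 4)
  obtain ⟨N, hN⟩ := Metric.cauchySeq_iff'.1 (hA.cauchySeq_of_mem hh t) (δ / 4) (by positivity)
  refine ⟨N, fun n hn => ?_⟩
  have h1 : ∀ k, dist (flow (A k) t f) (flow (A k) t h) < δ / 4 := by
    intro k
    rwa [dist_eq_norm, ← map_sub, hA.norm_flow, ← dist_eq_norm]
  have h2 := dist_triangle4 (flow (A n) t f) (flow (A n) t h) (flow (A N) t h) (flow (A N) t f)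
  have h3 := h1 N
  rw [dist_comm] at h3
  linarith [h1 n, hN n hn]

/-- The strong limit of the approximating flows. -/
def limit (t : ℝ) : H →L[ℝ] H :=
  LinearMap.mkContinuous
    { toFun := fun f => (hA.exists_tendsto t f).choose
      map_add' := fun f g => tendsto_nhds_unique (hA.exists_tendsto t (f + g)).choose_spec (by
        simpa using (hA.exists_tendsto t f).choose_spec.add (hA.exists_tendsto t g).choose_spec)
      map_smul' := fun r f => tendsto_nhds_unique (hA.exists_tendsto t (r • f)).choose_spec (by
        simpa using (hA.exists_tendsto t f).choose_spec.const_smul r) } 1 fun f => by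
    have h := (hA.exists_tendsto t f).choose_spec.norm
    simp only [hA.norm_flow] at h
    rw [one_mul]
    exact (tendsto_nhds_unique h tendsto_const_nhds).le

theorem tendsto_limit (t : ℝ) (f : H) :
    Tendsto (fun n => flow (A n) t f) atTop (𝓝 (hA.limit t f)) :=
  (hA.exists_tendsto t f).choose_spec

theorem norm_limit (t : ℝ) (f : H) : ‖hA.limit t f‖ = ‖f‖ := by
  have h := (hA.tendsto_limit t f).norm
  simp only [hA.norm_flow] at h
  exact tendsto_nhds_unique h tendsto_const_nhds

theorem limit_zero (f : H) : hA.limit 0 f = f :=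
  tendsto_nhds_unique (hA.tendsto_limit 0 f) (by simp [flow_zero])

theorem tendsto_flow_of_tendsto (t : ℝ) {u : ℕ → H} {f : H} (hu : Tendsto u atTop (𝓝 f)) :
    Tendsto (fun n => flow (A n) t (u n)) atTop (𝓝 (hA.limit t f)) := by
  have h : Tendsto (fun n => flow (A n) t (u n - f)) atTop (𝓝 0) := by
    rw [tendsto_zero_iff_norm_tendsto_zero]
    simp only [hA.norm_flow]
    exact tendsto_zero_iff_norm_tendsto_zero.1 (by simpa using hu.sub_const f)
  simpa using h.add (hA.tendsto_limit t f)

theorem limit_add (s t : ℝ) (f : H) : hA.limit (s + t) f = hA.limit s (hA.limit t f) := by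
  refine tendsto_nhds_unique (hA.tendsto_limit (s + t) f) ?_
  simp only [flow_add, mul_apply_eq_comp]
  exact hA.tendsto_flow_of_tendsto s (hA.tendsto_limit t f)

theorem commute_limit {B : H →L[ℝ] H} (hB : ∀ n f, B (A n f) = A n (B f)) (t : ℝ) (f : H) :
    B (hA.limit t f) = hA.limit t (B f) := by
  refine tendsto_nhds_unique ((B.continuous.tendsto _).comp (hA.tendsto_limit t f)) ?_
  refine (hA.tendsto_limit t (B f)).congr fun n => ?_
  have h : Commute B (A n) := ContinuousLinearMap.ext (hB n)
  have h1 : Commute B (flow (A n) t) := (h.smul_right t).exp_right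
  exact (congrArg (fun B : H →L[ℝ] H => B f) h1.eq).symm

theorem continuous_limit (f : H) : Continuous fun t => hA.limit t f := by
  have hD : ∀ h ∈ D, Continuous fun t => hA.limit t h := by
    intro h hh
    obtain ⟨g, hg⟩ := hA.eventually_eq h hh
    -- For large `n` the velocity of the orbit of `h` is the flow applied to the fixed vector `g`,
    -- of norm `‖g‖`, so one Lipschitz constant serves all these orbits and passes to the limit.
    refine LipschitzWith.continuous (K := ‖g‖₊) (LipschitzWith.of_dist_le_mul fun t s => ?_)
    rw [dist_eq_norm, dist_eq_norm, coe_nnnorm]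
    refine le_of_tendsto ((hA.tendsto_limit t h).sub (hA.tendsto_limit s h)).norm ?_
    filter_upwards [hg] with n hn
    refine convex_univ.norm_image_sub_le_of_norm_hasDerivWithin_le
      (f := fun t => flow (A n) t h) (f' := fun t => flow (A n) t g) (fun r _ => ?_) (fun r _ => (hA.norm_flow n r g).le)
      (Set.mem_univ s) (Set.mem_univ t)
    rw [← hn]
    exact (hasDerivAt_flow_apply (A n) r h).hasDerivWithinAt
  obtain ⟨u, hu, hlim⟩ := mem_closure_iff_seq_limit.1 (hA.dense f)
  have hunif : TendstoUniformly (fun n t => hA.limit t (u n)) (fun t => hA.limit t f) atTop := by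
    refine Metric.tendstoUniformly_iff.2 fun ε hε => ?_
    filter_upwards [Metric.tendsto_nhds.1 hlim ε hε] with n hn t
    rwa [dist_eq_norm, ← map_sub, hA.norm_limit, ← dist_eq_norm, dist_comm]
  exact hunif.continuous (Frequently.of_forall fun n => hD _ (hu n))

theorem limit_sub_self_of_mem {x : H × H} (hx : x ∈ eventualGraph A D) (t : ℝ) :
    hA.limit t x.1 - x.1 = ∫ s in (0 : ℝ)..t, hA.limit s x.2 := by
  refine tendsto_nhds_unique ((hA.tendsto_limit t x.1).sub_const x.1) ?_
  have h1 : Tendsto (fun n => ∫ s in (0 : ℝ)..t, flow (A n) s x.2) atTop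
      (𝓝 (∫ s in (0 : ℝ)..t, hA.limit s x.2)) := by
    refine intervalIntegral.tendsto_integral_filter_of_dominated_convergence (fun _ => ‖x.2‖)
      (Eventually.of_forall fun n => ?_) (Eventually.of_forall fun n =>
        Eventually.of_forall fun s _ => (hA.norm_flow n s x.2).le) (by simp)
      (Eventually.of_forall fun s _ => hA.tendsto_limit s x.2)
    exact (continuous_iff_continuousAt.2 fun s =>
      (hasDerivAt_flow_apply (A n) s x.2).continuousAt).aestronglyMeasurable
  refine h1.congr' ?_
  filter_upwards [hx.2] with n hn
  rw [intervalIntegral.integral_eq_sub_of_hasDerivAt (f := fun s => flow (A n) s x.1)]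
  · simp [flow_zero]
  · intro s _
    rw [← hn]
    exact hasDerivAt_flow_apply (A n) s x.1
  · exact (continuous_iff_continuousAt.2 fun s =>
      (hasDerivAt_flow_apply (A n) s x.2).continuousAt).intervalIntegrable _ _

theorem limit_sub_self {x : H × H} (hx : x ∈ (eventualGraph A D).topologicalClosure) (t : ℝ) :
    hA.limit t x.1 - x.1 = ∫ s in (0 : ℝ)..t, hA.limit s x.2 := by
  obtain ⟨u, hu, hlim⟩ := mem_closure_iff_seq_limit.1 hx
  have h1 : Tendsto (fun n => (u n).1) atTop (𝓝 x.1) := (continuous_fst.tendsto x).comp hlim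
  have h2 : Tendsto (fun n => (u n).2) atTop (𝓝 x.2) := (continuous_snd.tendsto x).comp hlim
  refine tendsto_nhds_unique ((((hA.limit t).continuous.tendsto x.1).comp h1).sub h1) ?_
  have h3 : Tendsto (fun n => ∫ s in (0 : ℝ)..t, hA.limit s (u n).2) atTop
      (𝓝 (∫ s in (0 : ℝ)..t, hA.limit s x.2)) := by
    obtain ⟨C, hC⟩ := h2.norm.bddAbove_range
    refine intervalIntegral.tendsto_integral_filter_of_dominated_convergence (fun _ => C)
      (Eventually.of_forall fun n => (hA.continuous_limit _).aestronglyMeasurable)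
      (Eventually.of_forall fun n => Eventually.of_forall fun s _ => ?_) (by simp)
      (Eventually.of_forall fun s _ => ((hA.limit s).continuous.tendsto x.2).comp h2)
    rw [hA.norm_limit]
    exact hC ⟨n, rfl⟩
  exact h3.congr fun n => (hA.limit_sub_self_of_mem (hu n) t).symm

theorem hasDerivAt_limit {x : H × H} (hx : x ∈ (eventualGraph A D).topologicalClosure) :
    HasDerivAt (fun t => hA.limit t x.1) x.2 0 := by
  have h := intervalIntegral.integral_hasDerivAt_right (a := 0) (b := 0)
    ((hA.continuous_limit x.2).intervalIntegrable _ _)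
    ((hA.continuous_limit x.2).stronglyMeasurableAtFilter _ _)
    (hA.continuous_limit x.2).continuousAt
  rw [hA.limit_zero] at h
  refine (h.add_const x.1).congr_of_eventuallyEq (Eventually.of_forall fun t => ?_)
  simp only
  rw [← hA.limit_sub_self hx t, sub_add_cancel]

/-- The closed graph is invariant under the limit group. The approximate orbit stays in `D`, and
there the eventual value of the operators differs from `A n` by at most the defect, while `A n`
commutes with its own flow. -/
theorem limit_mem_of_mem {x : H × H} (hx : x ∈ eventualGraph A D) (t : ℝ) :
    (hA.limit t x.1, hA.limit t x.2) ∈ (eventualGraph A D).topologicalClosure := by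
  obtain ⟨ε, hε, hev⟩ := hA.defect x.1 hx.1 |t|
  have hex : ∀ n, ∃ g, flow (A n) t x.1 ∈ D →
      (flow (A n) t x.1, g) ∈ eventualGraph A D := by
    intro n
    by_cases hn : flow (A n) t x.1 ∈ D
    · obtain ⟨g, hg⟩ := hA.eventually_eq _ hn
      exact ⟨g, fun _ => ⟨hn, hg⟩⟩
    · exact ⟨0, fun h => absurd h hn⟩
  choose g hg using hex
  have hlim : Tendsto g atTop (𝓝 (hA.limit t x.2)) := by
    have h0 : Tendsto (fun n => g n - flow (A n) t x.2) atTop (𝓝 0) := by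
      refine squeeze_zero_norm' ?_ hε
      filter_upwards [hev, hA.flow_mem x.1 hx.1, hx.2] with n h1 h2 h3
      obtain ⟨m, hm⟩ := eventually_atTop.1 (hg n (h2 t)).2
      have h4 := h1 (max m n) (le_max_right _ _) t le_rfl
      rw [hm _ (le_max_left _ _), apply_flow, h3] at h4
      exact h4
    simpa using h0.add (hA.tendsto_limit t x.2)
  refine mem_closure_of_tendsto ((hA.tendsto_limit t x.1).prodMk_nhds hlim) ?_
  filter_upwards [hA.flow_mem x.1 hx.1] with n hn
  exact hg n (hn t)

theorem average_mem {x : H × H} (hx : x ∈ eventualGraph A D) {t : ℝ} (ht : 0 < t) :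
    (∫ s in (0 : ℝ)..t, hA.limit s x.1, hA.limit t x.1 - x.1) ∈
      (eventualGraph A D).topologicalClosure := by
  have hc1 := hA.continuous_limit x.1
  have hc2 := hA.continuous_limit x.2
  have hint : IntegrableOn (fun s => (hA.limit s x.1, hA.limit s x.2)) (Set.Ioc 0 t) :=
    ((hc1.prodMk hc2).integrableOn_Icc (a := 0) (b := t)).mono_set Set.Ioc_subset_Icc_self
  -- A time average of points of a closed subspace stays in it. The second component of the integral
  -- is then computed by the fundamental theorem of calculus.
  have h := ((eventualGraph A D).topologicalClosure.convex).set_average_mem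
    (μ := volume) (t := Set.Ioc 0 t) (f := fun s => (hA.limit s x.1, hA.limit s x.2))
    (eventualGraph A D).isClosed_topologicalClosure (by simp [ht]) (by simp)
    (Eventually.of_forall fun s => hA.limit_mem_of_mem hx s) hint
  rw [setAverage_eq, Measure.real, Real.volume_Ioc, sub_zero, ENNReal.toReal_ofReal ht.le] at h
  have h' := (eventualGraph A D).topologicalClosure.smul_mem t h
  rw [smul_inv_smul₀ ht.ne', integral_pair hint.fst hint.snd,
    ← intervalIntegral.integral_of_le ht.le, ← intervalIntegral.integral_of_le ht.le,
    ← hA.limit_sub_self_of_mem hx] at h'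
  exact h'

theorem average_mem_closure (f : H) {t : ℝ} (ht : 0 < t) :
    (∫ s in (0 : ℝ)..t, hA.limit s f, hA.limit t f - f) ∈
      (eventualGraph A D).topologicalClosure := by
  obtain ⟨u, hu, hlim⟩ := mem_closure_iff_seq_limit.1 (hA.dense f)
  have h3 : Tendsto (fun n => ∫ s in (0 : ℝ)..t, hA.limit s (u n)) atTop
      (𝓝 (∫ s in (0 : ℝ)..t, hA.limit s f)) := by
    obtain ⟨C, hC⟩ := hlim.norm.bddAbove_range
    refine intervalIntegral.tendsto_integral_filter_of_dominated_convergence (fun _ => C)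
      (Eventually.of_forall fun n => (hA.continuous_limit _).aestronglyMeasurable)
      (Eventually.of_forall fun n => Eventually.of_forall fun s _ => ?_) (by simp)
      (Eventually.of_forall fun s _ => ((hA.limit s).continuous.tendsto f).comp hlim)
    rw [hA.norm_limit]
    exact hC ⟨n, rfl⟩
  have h4 := h3.prodMk_nhds ((((hA.limit t).continuous.tendsto f).comp hlim).sub hlim)
  refine (eventualGraph A D).isClosed_topologicalClosure.mem_of_tendsto h4
    (Eventually.of_forall fun n => ?_)
  obtain ⟨g, hg⟩ := hA.eventually_eq (u n) (hu n)
  exact hA.average_mem (x := (u n, g)) ⟨hu n, hg⟩ ht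

/-- That nothing outside the closure is differentiable: by `average_mem_closure` the time averages
of the orbit of any `f` lie in the closed graph, with the difference quotients as images. As `t`
decreases to `0` these pairs tend to `(f, g)`. -/
theorem hasDerivAt_limit_iff (f g : H) :
    HasDerivAt (fun t => hA.limit t f) g 0 ↔
      (f, g) ∈ (eventualGraph A D).topologicalClosure := by
  refine ⟨fun h => ?_, fun h => hA.hasDerivAt_limit h⟩
  have hmono : 𝓝[>] (0 : ℝ) ≤ 𝓝[≠] 0 := nhdsWithin_mono 0 fun t ht => ne_of_gt ht
  have h1 := (hasDerivAt_iff_tendsto_slope_zero.1 h).mono_left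
    hmono
  have h2 := (hasDerivAt_iff_tendsto_slope_zero.1
    (intervalIntegral.integral_hasDerivAt_right (a := 0) (b := 0)
    ((hA.continuous_limit f).intervalIntegrable _ _)
    ((hA.continuous_limit f).stronglyMeasurableAtFilter _ _)
    (hA.continuous_limit f).continuousAt)).mono_left
    hmono
  simp only [zero_add, hA.limit_zero, intervalIntegral.integral_same, sub_zero] at h1 h2
  refine (eventualGraph A D).isClosed_topologicalClosure.mem_of_tendsto (h2.prodMk_nhds h1) ?_
  filter_upwards [self_mem_nhdsWithin] with t ht
  exact (eventualGraph A D).topologicalClosure.smul_mem t⁻¹ (hA.average_mem_closure f ht)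

end IsFlowApprox

end StrongLimit

/-! ### Ladder operators in quaternionic coordinates -/

section Ladder

/-- Grönwall in both time directions: `φ t * exp (-M * t)` is antitone and `φ t * exp (M * t)` is
monotone. -/
theorem le_mul_exp_of_abs_deriv_le {φ φ' : ℝ → ℝ} {M : ℝ} (hφ : ∀ t, HasDerivAt φ (φ' t) t)
    (hM : ∀ t, |φ' t| ≤ M * φ t) (t : ℝ) : φ t ≤ φ 0 * Real.exp (M * |t|) := by
  have hd : ∀ c t, HasDerivAt (fun t => φ t * Real.exp (c * t))
      ((φ' t + c * φ t) * Real.exp (c * t)) t := by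
    intro c t
    have h1 : HasDerivAt (fun t => Real.exp (c * t)) (Real.exp (c * t) * (c * 1)) t :=
      ((hasDerivAt_id t).const_mul c).exp
    refine ((hφ t).fun_mul h1).congr_deriv ?_
    ring
  rcases le_total 0 t with ht | ht
  · have h1 : Antitone fun t => φ t * Real.exp (-M * t) :=
      antitone_of_deriv_nonpos (fun t => (hd _ t).differentiableAt) fun t => by
        rw [(hd _ t).deriv]
        refine mul_nonpos_of_nonpos_of_nonneg ?_ (Real.exp_pos _).le
        linarith [(abs_le.1 (hM t)).2]
    have h2 := h1 ht
    simp only [mul_zero, Real.exp_zero, mul_one] at h2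
    rwa [abs_of_nonneg ht, ← div_le_iff₀ (Real.exp_pos _), div_eq_mul_inv, ← Real.exp_neg,
      ← neg_mul]
  · have h1 : Monotone fun t => φ t * Real.exp (M * t) :=
      monotone_of_deriv_nonneg (fun t => (hd _ t).differentiableAt) fun t => by
        rw [(hd _ t).deriv]
        refine mul_nonneg ?_ (Real.exp_pos _).le
        linarith [(abs_le.1 (hM t)).1]
    have h2 := h1 ht
    simp only [mul_zero, Real.exp_zero, mul_one] at h2
    rwa [abs_of_nonpos ht, ← div_le_iff₀ (Real.exp_pos _), div_eq_mul_inv, ← Real.exp_neg,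
      mul_neg, neg_neg]

/-- Coordinates of a real Banach space with respect to a quaternionic orthonormal basis. -/
structure Coordinates (H : Type*) [NormedAddCommGroup H] [NormedSpace ℝ H] where
  /-- The coordinate functions. -/
  coeff : ℕ → H →L[ℝ] ℍ
  /-- The multiples of the basis vectors. -/
  ket : ℕ → ℍ →L[ℝ] H
  coeff_ket : ∀ j k h, coeff j (ket k h) = if j = k then h else 0
  parseval : ∀ f, HasSum (fun k => ‖coeff k f‖ ^ 2) (‖f‖ ^ 2)

variable {H : Type*} [NormedAddCommGroup H] [NormedSpace ℝ H]

namespace Coordinates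

variable (K : Coordinates H)

theorem norm_ket (k : ℕ) (h : ℍ) : ‖K.ket k h‖ = ‖h‖ := by
  have h1 := K.parseval (K.ket k h)
  have h2 : HasSum (fun j => ‖K.coeff j (K.ket k h)‖ ^ 2) (‖h‖ ^ 2) := by
    convert hasSum_ite_eq k (‖h‖ ^ 2) using 2 with j
    rw [K.coeff_ket]
    split_ifs <;> simp
  exact (sq_eq_sq₀ (norm_nonneg _) (norm_nonneg _)).1 (h1.unique h2)

/-- The projection onto the first `N` coordinates. -/
def proj (N : ℕ) (f : H) : H := ∑ k ∈ Finset.range N, K.ket k (K.coeff k f)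

theorem coeff_proj (N j : ℕ) (f : H) :
    K.coeff j (K.proj N f) = if j < N then K.coeff j f else 0 := by
  simp only [proj, map_sum, K.coeff_ket]
  rw [Finset.sum_ite_eq]
  simp

theorem tendsto_proj (f : H) : Tendsto (fun N => K.proj N f) atTop (𝓝 f) := by
  -- Parseval identifies the squared error with the tail of the series for `‖f‖ ^ 2`.
  have h1 : ∀ N, ‖K.proj N f - f‖ ^ 2 =
      ‖f‖ ^ 2 - ∑ k ∈ Finset.range N, ‖K.coeff k f‖ ^ 2 := by
    intro N
    have h2 : HasSum (fun k => if k < N then ‖K.coeff k f‖ ^ 2 else 0)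
        (∑ k ∈ Finset.range N, ‖K.coeff k f‖ ^ 2) := by
      rw [← Finset.sum_congr rfl (fun k hk => if_pos (Finset.mem_range.1 hk))]
      exact hasSum_sum_of_ne_finset_zero fun k hk => if_neg (by simpa using hk)
    refine (K.parseval _).unique (((K.parseval f).sub h2).congr_fun ?_)
    intro k
    rw [map_sub, coeff_proj]
    split_ifs <;> simp
  rw [← tendsto_sub_nhds_zero_iff, tendsto_zero_iff_norm_tendsto_zero]
  have h3 : Tendsto (fun N => ‖K.proj N f - f‖ ^ 2) atTop (𝓝 0) := by
    simp only [h1]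
    have h4 := (K.parseval f).tendsto_sum_nat.const_sub (‖f‖ ^ 2)
    rwa [sub_self] at h4
  simpa using h3.sqrt

/-- The vectors with finitely many nonzero coordinates. -/
def finiteVectors : Submodule ℝ H where
  carrier := {f | ∃ N, ∀ k ≥ N, K.coeff k f = 0}
  add_mem' := by
    rintro f g ⟨N, hN⟩ ⟨M, hM⟩
    refine ⟨max N M, fun k hk => ?_⟩
    rw [map_add, hN k (le_of_max_le_left hk), hM k (le_of_max_le_right hk), add_zero]
  zero_mem' := ⟨0, fun k _ => map_zero _⟩
  smul_mem' := by
    rintro r f ⟨N, hN⟩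
    exact ⟨N, fun k hk => by rw [map_smul, hN k hk, smul_zero]⟩

theorem proj_mem (N : ℕ) (f : H) : K.proj N f ∈ K.finiteVectors :=
  ⟨N, fun k hk => by rw [coeff_proj, if_neg hk.not_gt]⟩

variable (d : ℕ) (α : ℕ → ℝ) (p : ℍ)

/-- The truncation to `k < n` of the skew-adjoint operator that takes the `k`-th basis vector to
`α k` times `p` times the `k + d`-th one, minus the adjoint. -/
def ladder (n : ℕ) : H →L[ℝ] H :=
  ∑ k ∈ Finset.range n, α k •
    (K.ket (k + d) ∘L ContinuousLinearMap.mul ℝ ℍ p ∘L K.coeff k -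
      K.ket k ∘L ContinuousLinearMap.mul ℝ ℍ (star p) ∘L K.coeff (k + d))

theorem ladder_apply (n : ℕ) (f : H) : K.ladder d α p n f = ∑ k ∈ Finset.range n, α k •
    (K.ket (k + d) (p * K.coeff k f) - K.ket k (star p * K.coeff (k + d) f)) := by
  simp [ladder]

theorem coeff_ladder_of_le {n k : ℕ} (hk : n + d ≤ k) (f : H) :
    K.coeff k (K.ladder d α p n f) = 0 := by
  rw [ladder_apply, map_sum]
  refine Finset.sum_eq_zero fun j hj => ?_
  have hj' := Finset.mem_range.1 hj
  rw [map_smul, map_sub, K.coeff_ket, K.coeff_ket, if_neg (by omega), if_neg (by omega), sub_zero,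
    smul_zero]

/-- Each rung couples places `k` and `k + d` skew-symmetrically, so it contributes only through the
difference of the weights there. Constant weights give isometry, quartic ones the uniform estimate.
-/
theorem sum_inner_coeff_ladder (w : ℕ → ℝ) {n N : ℕ} (hN : n + d ≤ N) (f : H) :
    ∑ j ∈ Finset.range N, w j * (2 * inner ℝ (K.coeff j f) (K.coeff j (K.ladder d α p n f))) =
      ∑ k ∈ Finset.range n, 2 * α k * (w (k + d) - w k) *
        inner ℝ (K.coeff (k + d) f) (p * K.coeff k f) := by
  have hstep : ∀ j k, inner ℝ (K.coeff j f) (K.coeff j (α k •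
      (K.ket (k + d) (p * K.coeff k f) - K.ket k (star p * K.coeff (k + d) f)))) =
      (if j = k + d then α k * inner ℝ (K.coeff (k + d) f) (p * K.coeff k f) else 0) -
        (if j = k then α k * inner ℝ (K.coeff (k + d) f) (p * K.coeff k f) else 0) := by
    intro j k
    have hadj : inner ℝ (K.coeff k f) (star p * K.coeff (k + d) f) =
        inner ℝ (K.coeff (k + d) f) (p * K.coeff k f) := by
      simp only [Quaternion.inner_def, Quaternion.re_mul, Quaternion.re_star, Quaternion.imI_star,
        Quaternion.imJ_star, Quaternion.imK_star, Quaternion.imI_mul, Quaternion.imJ_mul,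
        Quaternion.imK_mul]
      ring
    rw [map_smul, map_sub, K.coeff_ket, K.coeff_ket, inner_smul_right, inner_sub_right, mul_sub]
    congr 1
    · split_ifs with h
      · rw [h]
      · simp
    · split_ifs with h
      · rw [h, hadj]
      · simp
  simp only [ladder_apply, map_sum, inner_sum, hstep, Finset.mul_sum]
  rw [Finset.sum_comm]
  refine Finset.sum_congr rfl fun k hk => ?_
  have hk' := Finset.mem_range.1 hk
  simp only [mul_sub, mul_ite, mul_zero, Finset.sum_sub_distrib, Finset.sum_ite_eq']
  rw [if_pos (Finset.mem_range.2 (by omega)), if_pos (Finset.mem_range.2 (by omega))]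
  ring

/-- Shows that finite vectors are a core: truncating `f` yields points of the graph whose images are
partial sums of the raising and lowering series. -/
theorem closure_mem_of_tendsto {f a b : H}
    (ha : Tendsto (fun n => ∑ k ∈ Finset.range n, K.ket (k + d) (α k • (p * K.coeff k f)))
      atTop (𝓝 a))
    (hb : Tendsto (fun n => ∑ k ∈ Finset.range n, K.ket k (α k • (star p * K.coeff (k + d) f)))
      atTop (𝓝 b)) :
    (f, a - b) ∈ (eventualGraph (K.ladder d α p) K.finiteVectors).topologicalClosure := by
  -- Keeping `N + d` coordinates of `f` leaves `N + d` raising terms but only `N` lowering terms,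
  -- since the latter read coordinate `k + d`.
  have h1 := ((tendsto_add_atTop_iff_nat d).2 (K.tendsto_proj f)).prodMk_nhds
    (((tendsto_add_atTop_iff_nat d).2 ha).sub hb)
  refine mem_closure_of_tendsto h1 (Eventually.of_forall fun N => ⟨K.proj_mem _ _, ?_⟩)
  filter_upwards [eventually_ge_atTop (N + d)] with m hm
  rw [ladder_apply]
  simp only [coeff_proj, smul_sub, Finset.sum_sub_distrib]
  congr 1
  · rw [← Finset.sum_subset (Finset.range_mono hm)]
    · refine Finset.sum_congr rfl fun k hk => ?_
      rw [if_pos (Finset.mem_range.1 hk), map_smul]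
    · intro k _ hk
      rw [if_neg (by simpa using hk), mul_zero, map_zero, smul_zero]
  · rw [← Finset.sum_subset (Finset.range_mono (show N ≤ m by omega))]
    · refine Finset.sum_congr rfl fun k hk => ?_
      rw [if_pos (by have := Finset.mem_range.1 hk; omega), map_smul]
    · intro k _ hk
      rw [if_neg (by have := Finset.mem_range.not.1 hk; omega), mul_zero, map_zero, smul_zero]

section

variable {d α p} {C : ℝ}

theorem ladder_eq_of_le {N : ℕ} {f : H} (hf : ∀ k ≥ N, K.coeff k f = 0) {n : ℕ} (hn : N ≤ n) :
    K.ladder d α p n f = K.ladder d α p N f := by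
  rw [ladder_apply, ladder_apply, ← Finset.sum_subset (Finset.range_mono hn)]
  intro k _ hk
  have hk' : N ≤ k := by simpa using hk
  rw [hf k hk', hf (k + d) (by omega), mul_zero, mul_zero, map_zero, map_zero, sub_zero, smul_zero]

/-- A vector supported below `n + d` meets only the `d` rungs `n ≤ k < n + d` of the difference.
There the quartic weight bounds the coordinate by `S / (k + 1) ^ 2`, which beats the linear growth
of `α` and leaves a factor `1 / (n + 1)`. -/
theorem norm_ladder_sub_le (hC : ∀ k, |α k| ≤ C * (k + 1)) {n m : ℕ} (hm : n ≤ m) {u : H}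
    (hu : ∀ k ≥ n + d, K.coeff k u = 0) {S : ℝ}
    (hS : ∑ j ∈ Finset.range (n + d), (j + 1 : ℝ) ^ 4 * ‖K.coeff j u‖ ^ 2 ≤ S ^ 2) (hS0 : 0 ≤ S) :
    ‖K.ladder d α p m u - K.ladder d α p n u‖ ≤ d * (C * ‖p‖ * S / (n + 1)) := by
  have hC0 : 0 ≤ C := by simpa using (abs_nonneg _).trans (hC 0)
  rw [ladder_apply, ladder_apply, ← Finset.sum_Ico_eq_sub _ hm]
  have hterm : ∀ k ∈ Finset.Ico n m, ‖α k • (K.ket (k + d) (p * K.coeff k u) -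
      K.ket k (star p * K.coeff (k + d) u))‖ ≤
        if k < n + d then C * ‖p‖ * S / (n + 1) else 0 := by
    intro k hk
    have hnk := (Finset.mem_Ico.1 hk).1
    rw [hu (k + d) (by omega), mul_zero, map_zero, sub_zero, norm_smul, K.norm_ket, norm_mul,
      Real.norm_eq_abs]
    split_ifs with h
    · have h1 : ((k + 1 : ℝ) ^ 2 * ‖K.coeff k u‖) ^ 2 ≤ S ^ 2 := by
        refine le_trans (le_of_eq ?_) ((Finset.single_le_sum (f := fun j : ℕ =>
          (j + 1 : ℝ) ^ 4 * ‖K.coeff j u‖ ^ 2) (fun j _ => by positivity)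
          (Finset.mem_range.2 h)).trans hS)
        ring
      have h2 : (k + 1 : ℝ) ^ 2 * ‖K.coeff k u‖ ≤ S := by
        refine (sq_le_sq₀ (by positivity) hS0).1 h1
      have h3 : (n + 1 : ℝ) ≤ k + 1 := by gcongr
      rw [le_div_iff₀ (by positivity)]
      calc |α k| * (‖p‖ * ‖K.coeff k u‖) * (n + 1)
          ≤ C * (k + 1) * (‖p‖ * ‖K.coeff k u‖) * (k + 1) := by
            gcongr
            exact hC k
        _ = C * ‖p‖ * ((k + 1 : ℝ) ^ 2 * ‖K.coeff k u‖) := by ring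
        _ ≤ C * ‖p‖ * S := by gcongr
    · rw [hu k (by omega), norm_zero, mul_zero, mul_zero]
  refine (norm_sum_le _ _).trans ((Finset.sum_le_sum hterm).trans ?_)
  rw [← Finset.sum_filter, Finset.sum_const, nsmul_eq_mul]
  gcongr
  have hsub : (Finset.Ico n m).filter (fun k => k < n + d) ⊆ Finset.Ico n (n + d) := by
    intro k hk
    simp only [Finset.mem_filter, Finset.mem_Ico] at hk ⊢
    omega
  simpa using Finset.card_le_card hsub

end

/-! ### Isometry and uniform weighted bounds for the truncated flows -/

variable [CompleteSpace H]

theorem hasDerivAt_weight (w : ℕ → ℝ) {n N : ℕ} (hN : n + d ≤ N) (f : H) (t : ℝ) :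
    HasDerivAt (fun t => ∑ j ∈ Finset.range N,
        w j * ‖K.coeff j (flow (K.ladder d α p n) t f)‖ ^ 2)
      (∑ k ∈ Finset.range n, 2 * α k * (w (k + d) - w k) *
        inner ℝ (K.coeff (k + d) (flow (K.ladder d α p n) t f))
          (p * K.coeff k (flow (K.ladder d α p n) t f))) t := by
  rw [← K.sum_inner_coeff_ladder d α p w hN]
  refine HasDerivAt.fun_sum fun j _ => HasDerivAt.const_mul (w j) (HasDerivAt.norm_sq ?_)
  rw [apply_flow]
  exact (K.coeff j).hasFDerivAt.comp_hasDerivAt t (hasDerivAt_flow_apply _ t f)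

theorem norm_flow_ladder (n : ℕ) (t : ℝ) (f : H) : ‖flow (K.ladder d α p n) t f‖ = ‖f‖ := by
  have h1 : ∀ N ≥ n + d, ∑ j ∈ Finset.range N, ‖K.coeff j (flow (K.ladder d α p n) t f)‖ ^ 2 =
      ∑ j ∈ Finset.range N, ‖K.coeff j f‖ ^ 2 := by
    intro N hN
    have h2 := fun s => K.hasDerivAt_weight d α p (fun _ => 1) hN f s
    simp only [sub_self, mul_zero, zero_mul, Finset.sum_const_zero, one_mul] at h2
    have h3 := is_const_of_deriv_eq_zero (fun s => (h2 s).differentiableAt)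
      (fun s => (h2 s).deriv) t 0
    simpa [flow_zero] using h3
  have h4 := (K.parseval (flow (K.ladder d α p n) t f)).tendsto_sum_nat
  have h5 := tendsto_nhds_unique (h4.congr' (eventually_atTop.2 ⟨n + d, h1⟩))
    (K.parseval f).tendsto_sum_nat
  exact (sq_eq_sq₀ (norm_nonneg _) (norm_nonneg _)).1 h5

theorem coeff_flow_ladder_of_le {n k : ℕ} (hk : n + d ≤ k) (t : ℝ) (f : H) :
    K.coeff k (flow (K.ladder d α p n) t f) = K.coeff k f := by
  have h : ∀ s, HasDerivAt (fun s => K.coeff k (flow (K.ladder d α p n) s f)) 0 s := by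
    intro s
    have h1 := (K.coeff k).hasFDerivAt.comp_hasDerivAt s
      (hasDerivAt_flow_apply (K.ladder d α p n) s f)
    rwa [← apply_flow, K.coeff_ladder_of_le d α p hk] at h1
  have h2 := is_const_of_deriv_eq_zero (fun s => (h s).differentiableAt)
    (fun s => (h s).deriv) t 0
  simpa [flow_zero] using h2

/-- Expand both sides in powers of `d`: each coefficient on the left is dominated by the one on the
right, as `(k + 1) ^ j ≤ (k + 1) ^ 4` for `j ≤ 4`. -/
theorem pow_four_add_sub_le (d k : ℕ) :
    ((k + 1 : ℝ)) * (((k + d : ℕ) + 1 : ℝ) ^ 4 - (k + 1 : ℝ) ^ 4) ≤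
      (d + 1) ^ 4 * (k + 1 : ℝ) ^ 4 := by
  have hx : (0 : ℝ) ≤ k := k.cast_nonneg
  have hd : (0 : ℝ) ≤ d := d.cast_nonneg
  push_cast
  rw [← sub_nonneg]
  have : ((d : ℝ) + 1) ^ 4 * (k + 1 : ℝ) ^ 4 - (k + 1) * ((k + d + 1) ^ 4 - (k + 1) ^ 4) =
      (k + 1) * ((k + 1) ^ 3 + 6 * d ^ 2 * (k + 1) ^ 2 * k + 4 * d ^ 3 * (k + 1) * k * (k + 2) +
        d ^ 4 * k * (k ^ 2 + 3 * k + 3)) := by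
    ring
  rw [this]
  positivity

variable {d α p} {C : ℝ}

/-- The increment of a quartic weight is cubic, so multiplied by the linear bound on `α` it is again
at most a constant times the weight. Grönwall then gives a rate free of `n` and `N`. -/
theorem weight_le (hC : ∀ k, |α k| ≤ C * (k + 1)) {n N : ℕ} (hN : n + d ≤ N) (f : H) (t : ℝ) :
    ∑ j ∈ Finset.range N, (j + 1 : ℝ) ^ 4 * ‖K.coeff j (flow (K.ladder d α p n) t f)‖ ^ 2 ≤
      (∑ j ∈ Finset.range N, (j + 1 : ℝ) ^ 4 * ‖K.coeff j f‖ ^ 2) *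
        Real.exp (2 * C * (d + 1) ^ 4 * ‖p‖ * |t|) := by
  have hC0 : 0 ≤ C := by simpa using (abs_nonneg _).trans (hC 0)
  have h := le_mul_exp_of_abs_deriv_le (M := 2 * C * (d + 1) ^ 4 * ‖p‖)
    (K.hasDerivAt_weight d α p (fun j => (j + 1 : ℝ) ^ 4) hN f) (fun s => ?_) t
  · simpa [flow_zero] using h
  set u := flow (K.ladder d α p n) s f
  have hterm : ∀ k : ℕ, |2 * α k * (((k + d : ℕ) + 1 : ℝ) ^ 4 - (k + 1 : ℝ) ^ 4) *
      inner ℝ (K.coeff (k + d) u) (p * K.coeff k u)| ≤ C * (d + 1) ^ 4 * ‖p‖ *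
        ((k + 1 : ℝ) ^ 4 * ‖K.coeff k u‖ ^ 2 +
          ((k + d : ℕ) + 1 : ℝ) ^ 4 * ‖K.coeff (k + d) u‖ ^ 2) := by
    intro k
    have hmono : (k + 1 : ℝ) ^ 4 ≤ ((k + d : ℕ) + 1 : ℝ) ^ 4 := by
      gcongr
      simp
    have h1 : |inner ℝ (K.coeff (k + d) u) (p * K.coeff k u)| ≤
        ‖p‖ * (‖K.coeff (k + d) u‖ * ‖K.coeff k u‖) := by
      refine (abs_real_inner_le_norm _ _).trans (le_of_eq ?_)
      rw [norm_mul]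
      ring
    have h2 : 2 * (‖K.coeff (k + d) u‖ * ‖K.coeff k u‖) ≤
        ‖K.coeff k u‖ ^ 2 + ‖K.coeff (k + d) u‖ ^ 2 := by
      nlinarith [sq_nonneg (‖K.coeff (k + d) u‖ - ‖K.coeff k u‖)]
    have h3 : |α k| * (((k + d : ℕ) + 1 : ℝ) ^ 4 - (k + 1 : ℝ) ^ 4) ≤
        C * ((d + 1) ^ 4 * (k + 1 : ℝ) ^ 4) := by
      calc _ ≤ C * (k + 1) * (((k + d : ℕ) + 1 : ℝ) ^ 4 - (k + 1 : ℝ) ^ 4) :=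
            mul_le_mul_of_nonneg_right (hC k) (sub_nonneg.2 hmono)
        _ = C * ((k + 1) * (((k + d : ℕ) + 1 : ℝ) ^ 4 - (k + 1 : ℝ) ^ 4)) := by ring
        _ ≤ _ := mul_le_mul_of_nonneg_left (pow_four_add_sub_le d k) hC0
    rw [abs_mul, abs_mul, abs_mul, abs_two, abs_of_nonneg (sub_nonneg.2 hmono)]
    calc _ ≤ 2 * |α k| * (((k + d : ℕ) + 1 : ℝ) ^ 4 - (k + 1 : ℝ) ^ 4) *
          (‖p‖ * (‖K.coeff (k + d) u‖ * ‖K.coeff k u‖)) := by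
          refine mul_le_mul_of_nonneg_left h1 ?_
          have := sub_nonneg.2 hmono
          positivity
      _ = (|α k| * (((k + d : ℕ) + 1 : ℝ) ^ 4 - (k + 1 : ℝ) ^ 4)) *
          (‖p‖ * (2 * (‖K.coeff (k + d) u‖ * ‖K.coeff k u‖))) := by ring
      _ ≤ (C * ((d + 1) ^ 4 * (k + 1 : ℝ) ^ 4)) *
          (‖p‖ * (‖K.coeff k u‖ ^ 2 + ‖K.coeff (k + d) u‖ ^ 2)) := by
          gcongr
      _ = C * (d + 1) ^ 4 * ‖p‖ * ((k + 1 : ℝ) ^ 4 * ‖K.coeff k u‖ ^ 2 +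
          (k + 1 : ℝ) ^ 4 * ‖K.coeff (k + d) u‖ ^ 2) := by ring
      _ ≤ _ := by gcongr
  refine (Finset.abs_sum_le_sum_abs _ _).trans ((Finset.sum_le_sum fun k _ => hterm k).trans ?_)
  rw [← Finset.mul_sum, Finset.sum_add_distrib]
  have hs1 : ∑ k ∈ Finset.range n, (k + 1 : ℝ) ^ 4 * ‖K.coeff k u‖ ^ 2 ≤
      ∑ k ∈ Finset.range N, (k + 1 : ℝ) ^ 4 * ‖K.coeff k u‖ ^ 2 :=
    Finset.sum_le_sum_of_subset_of_nonneg (Finset.range_mono (by omega))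
      fun k _ _ => by positivity
  have hs2 : ∑ k ∈ Finset.range n, ((k + d : ℕ) + 1 : ℝ) ^ 4 * ‖K.coeff (k + d) u‖ ^ 2 ≤
      ∑ k ∈ Finset.range N, (k + 1 : ℝ) ^ 4 * ‖K.coeff k u‖ ^ 2 := by
    rw [← Finset.sum_image (s := Finset.range n) (g := fun k => k + d)
      (f := fun k : ℕ => (k + 1 : ℝ) ^ 4 * ‖K.coeff k u‖ ^ 2) (by intro a _ b _ h; simpa using h)]
    refine Finset.sum_le_sum_of_subset_of_nonneg ?_ fun k _ _ => by positivity
    intro k hk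
    obtain ⟨j, hj, rfl⟩ := Finset.mem_image.1 hk
    have := Finset.mem_range.1 hj
    exact Finset.mem_range.2 (by omega)
  -- The sums over `k` and over `k + d` are each at most the full weighted sum, hence the factor `2`
  -- in the rate.
  calc _ ≤ C * (d + 1) ^ 4 * ‖p‖ * (∑ k ∈ Finset.range N, (k + 1 : ℝ) ^ 4 * ‖K.coeff k u‖ ^ 2 +
        ∑ k ∈ Finset.range N, (k + 1 : ℝ) ^ 4 * ‖K.coeff k u‖ ^ 2) := by gcongr
    _ = _ := by ring

theorem isFlowApprox (p : ℍ) (hC : ∀ k, |α k| ≤ C * (k + 1)) :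
    IsFlowApprox (K.ladder d α p) K.finiteVectors where
  norm_flow := K.norm_flow_ladder d α p
  dense f := mem_closure_of_tendsto (K.tendsto_proj f) (Eventually.of_forall fun N => K.proj_mem N f)
  eventually_eq := by
    rintro h ⟨N, hN⟩
    exact ⟨_, eventually_atTop.2 ⟨N, fun n hn => K.ladder_eq_of_le hN hn⟩⟩
  flow_mem := by
    rintro h ⟨N, hN⟩
    refine eventually_atTop.2 ⟨N, fun n hn t => ⟨n + d, fun k hk => ?_⟩⟩
    rw [K.coeff_flow_ladder_of_le d α p hk, hN k (by omega)]
  defect := by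
    rintro h ⟨N, hN⟩ T
    -- The bound of `weight_le` at the final time `T`. The sum stops at the support of `h`, so `S`
    -- does not depend on `n`.
    set S : ℝ := √((∑ j ∈ Finset.range N, (j + 1 : ℝ) ^ 4 * ‖K.coeff j h‖ ^ 2) *
        Real.exp (2 * C * (d + 1) ^ 4 * ‖p‖ * T))
    have hC0 : 0 ≤ C := by simpa using (abs_nonneg _).trans (hC 0)
    refine ⟨fun n => d * (C * ‖p‖ * S / (n + 1)), ?_, ?_⟩
    · have h1 := (tendsto_one_div_add_atTop_nhds_zero_nat (𝕜 := ℝ)).const_mul (d * (C * ‖p‖ * S))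
      rw [mul_zero] at h1
      refine h1.congr fun n => ?_
      ring
    · refine eventually_atTop.2 ⟨N, fun n hn m hm t ht => K.norm_ladder_sub_le hC hm (fun k hk => ?_)
        ?_ (Real.sqrt_nonneg _)⟩
      · rw [K.coeff_flow_ladder_of_le d α p hk, hN k (by omega)]
      · rw [Real.sq_sqrt (by positivity)]
        refine (K.weight_le hC le_rfl h t).trans ?_
        rw [← Finset.sum_subset (Finset.range_mono (show N ≤ n + d by omega))]
        · gcongr
        · intro k _ hk
          rw [hN k (by simpa using hk), norm_zero]
          ring

end Coordinates

end Ladder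

/-! ### Integration in polar coordinates -/

section Polar

/-- Lebesgue measure on the coordinate domain. -/
def boxMeasure : Measure (ℝ × ℝ × ℝ × ℝ) := volume.restrict polarBox

theorem boxMeasure_eq_prod : boxMeasure =
    (volume.restrict (Set.Ici 0)).prod ((volume.restrict (Set.Ico 0 (2 * Real.pi))).prod
      ((volume.restrict (Set.Icc 0 Real.pi)).prod
        (volume.restrict (Set.Ico 0 (2 * Real.pi))))) := by
  rw [Measure.prod_restrict, Measure.prod_restrict, Measure.prod_restrict]
  rfl

theorem measurableSet_polarBox : MeasurableSet polarBox :=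
  measurableSet_Ici.prod (measurableSet_Ico.prod (measurableSet_Icc.prod measurableSet_Ico))

/-- The density of `polarMeasure w` in the coordinate domain. -/
def polarDensity (w : ℝ → ℝ) (x : ℝ × ℝ × ℝ × ℝ) : ENNReal :=
  ENNReal.ofReal (w x.1 * Real.sin x.2.2.1 / (4 * Real.pi ^ 2))

theorem polarMeasure_def (w : ℝ → ℝ) :
    polarMeasure w = (boxMeasure.withDensity (polarDensity w)).map polar := rfl

theorem measurable_polarDensity {w : ℝ → ℝ} (hw : Measurable w) : Measurable (polarDensity w) := by
  unfold polarDensity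
  fun_prop

theorem integral_polarMeasure {E : Type*} [NormedAddCommGroup E] [NormedSpace ℝ E] {w : ℝ → ℝ}
    (hw : Measurable w) {f : ℍ → E} (hf : AEStronglyMeasurable f (polarMeasure w)) :
    ∫ q, f q ∂polarMeasure w = ∫ x, (polarDensity w x).toReal • f (polar x) ∂boxMeasure := by
  rw [polarMeasure_def] at hf ⊢
  rw [integral_map measurable_polar.aemeasurable hf,
    integral_withDensity_eq_integral_toReal_smul (measurable_polarDensity hw)
      (Eventually.of_forall fun x => ENNReal.ofReal_lt_top)]

theorem integrable_polarMeasure {E : Type*} [NormedAddCommGroup E] [NormedSpace ℝ E] {w : ℝ → ℝ}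
    (hw : Measurable w) {f : ℍ → E} (hf : Integrable f (polarMeasure w)) :
    Integrable (fun x => (polarDensity w x).toReal • f (polar x)) boxMeasure := by
  rw [polarMeasure_def] at hf
  have h := (integrable_map_measure hf.aestronglyMeasurable measurable_polar.aemeasurable).1 hf
  exact (integrable_withDensity_iff_integrable_smul' (measurable_polarDensity hw)
    (Eventually.of_forall fun x => ENNReal.ofReal_lt_top)).1 h

/-- The density does not involve `θ`, so integrating over `θ` innermost isolates integrals over
circles lying in a single complex slice. -/
theorem integral_polarMeasure_eq_iterated {E : Type*} [NormedAddCommGroup E] [NormedSpace ℝ E]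
    {w : ℝ → ℝ} (hw : Measurable w) {f : ℍ → E} (hf : Integrable f (polarMeasure w)) :
    ∫ q, f q ∂polarMeasure w = ∫ r in Set.Ici 0,
      ∫ y : ℝ × ℝ, (ENNReal.ofReal (w r * Real.sin y.1 / (4 * Real.pi ^ 2))).toReal •
          (∫ θ : ℝ in Set.Ico 0 (2 * Real.pi), f (polar (r, θ, y)))
        ∂((volume.restrict (Set.Icc 0 Real.pi)).prod
          (volume.restrict (Set.Ico 0 (2 * Real.pi)))) := by
  have hint := integrable_polarMeasure hw hf
  rw [integral_polarMeasure hw hf.aestronglyMeasurable]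
  rw [boxMeasure_eq_prod] at hint ⊢
  rw [integral_prod _ hint]
  refine integral_congr_ae ?_
  filter_upwards [hint.prod_right_ae] with r hr
  rw [integral_prod_symm _ hr]
  refine integral_congr_ae (Eventually.of_forall fun y => ?_)
  simp only [polarDensity]
  rw [integral_smul]

/-- Two functions with the same integrals over almost all circles have the same integral. -/
theorem integral_polarMeasure_congr {E : Type*} [NormedAddCommGroup E] [NormedSpace ℝ E]
    {w : ℝ → ℝ} (hw : Measurable w) {f g : ℍ → E} (hf : Integrable f (polarMeasure w))
    (hg : Integrable g (polarMeasure w))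
    (h : ∀ r > 0, ∀ y : ℝ × ℝ, ∫ θ : ℝ in Set.Ico 0 (2 * Real.pi), f (polar (r, θ, y)) =
      ∫ θ : ℝ in Set.Ico 0 (2 * Real.pi), g (polar (r, θ, y))) :
    ∫ q, f q ∂polarMeasure w = ∫ q, g q ∂polarMeasure w := by
  rw [integral_polarMeasure_eq_iterated hw hf, integral_polarMeasure_eq_iterated hw hg,
    -- The radius `0` is dropped because the circle identities are assumed only for positive radii.
    integral_Ici_eq_integral_Ioi, integral_Ici_eq_integral_Ioi]
  refine setIntegral_congr_fun measurableSet_Ioi fun r hr => ?_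
  simp only [h r hr]

theorem integral_norm_pow (n : ℕ) :
    ∫ q, ‖q‖ ^ (2 * n) ∂gaussMeasure = (n.factorial : ℝ) := by
  have hw : Measurable fun r : ℝ => r * Real.exp (-r ^ 2) := by fun_prop
  rw [gaussMeasure, integral_polarMeasure hw (by fun_prop)]
  have h1 : ∀ x ∈ polarBox, (polarDensity (fun r => r * Real.exp (-r ^ 2)) x).toReal •
      ‖polar x‖ ^ (2 * n) = (x.1 ^ (2 * n + 1) * Real.exp (-x.1 ^ 2)) *
        (1 * ((Real.sin x.2.2.1 / (4 * Real.pi ^ 2)) * 1)) := by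
    rintro x ⟨hx1, -, hx3, -⟩
    have hx : 0 ≤ x.1 := hx1
    have hs : 0 ≤ Real.sin x.2.2.1 := Real.sin_nonneg_of_mem_Icc hx3
    rw [polarDensity, ENNReal.toReal_ofReal (by positivity), norm_polar, abs_of_nonneg hx,
      smul_eq_mul]
    ring
  rw [boxMeasure, setIntegral_congr_fun measurableSet_polarBox h1, ← boxMeasure,
    boxMeasure_eq_prod, integral_prod_mul (fun r : ℝ => r ^ (2 * n + 1) * Real.exp (-r ^ 2))
      (fun y : ℝ × ℝ × ℝ => 1 * ((Real.sin y.2.1 / (4 * Real.pi ^ 2)) * 1)),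
    integral_prod_mul (fun _ : ℝ => (1 : ℝ))
      (fun y : ℝ × ℝ => (Real.sin y.1 / (4 * Real.pi ^ 2)) * 1),
    integral_prod_mul (fun φ : ℝ => Real.sin φ / (4 * Real.pi ^ 2)) (fun _ : ℝ => (1 : ℝ))]
  have h2 : ∫ r in Set.Ici (0 : ℝ), r ^ (2 * n + 1) * Real.exp (-r ^ 2) =
      (n.factorial : ℝ) / 2 := by
    have h := integral_rpow_mul_exp_neg_rpow (p := 2) (q := ((2 * n + 1 : ℕ) : ℝ)) two_pos
      (lt_of_lt_of_le (by norm_num) (Nat.cast_nonneg _))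
    rw [show (((2 * n + 1 : ℕ) : ℝ) + 1) / 2 = n + 1 by push_cast; ring,
      Real.Gamma_nat_eq_factorial] at h
    rw [integral_Ici_eq_integral_Ioi]
    simp only [Real.rpow_natCast, Real.rpow_ofNat] at h
    rw [h]
    ring
  have h3 : ∫ φ in Set.Icc 0 Real.pi, Real.sin φ / (4 * Real.pi ^ 2) =
      2 / (4 * Real.pi ^ 2) := by
    rw [integral_Icc_eq_integral_Ioc, ← intervalIntegral.integral_of_le Real.pi_pos.le,
      intervalIntegral.integral_div, integral_sin]
    norm_num
  have h4 : ∫ _ in Set.Ico 0 (2 * Real.pi), (1 : ℝ) = 2 * Real.pi := by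
    simp [Real.pi_pos.le]
  rw [h2, h3, h4]
  have := Real.pi_ne_zero
  field_simp
  ring

theorem gaussMeasure_eq_withDensity : gaussMeasure =
    flatMeasure.withDensity fun q => ENNReal.ofReal (Real.exp (-‖q‖ ^ 2)) := by
  have hg : Measurable fun q : ℍ => ENNReal.ofReal (Real.exp (-‖q‖ ^ 2)) := by
    have : Continuous fun q : ℍ => Real.exp (-‖q‖ ^ 2) := by fun_prop
    exact this.measurable.ennreal_ofReal
  have hw : Measurable fun r : ℝ => r := measurable_id
  refine Measure.ext fun s hs => ?_
  have hs' := measurable_polar hs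
  rw [withDensity_apply _ hs, gaussMeasure, flatMeasure, polarMeasure_def, polarMeasure_def,
    setLIntegral_map hs hg measurable_polar, Measure.map_apply measurable_polar hs,
    withDensity_apply _ hs',
    setLIntegral_withDensity_eq_setLIntegral_mul (g := fun x => ENNReal.ofReal
      (Real.exp (-‖polar x‖ ^ 2))) _ (measurable_polarDensity hw)
      (hg.comp measurable_polar) hs']
  refine lintegral_congr fun x => ?_
  rw [Pi.mul_apply, polarDensity, polarDensity,
    ← ENNReal.ofReal_mul' (Real.exp_pos _).le, norm_polar, sq_abs]
  congr 1
  ring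

theorem measurePreserving_reflect : MeasurePreserving
    (fun x : ℝ × ℝ × ℝ × ℝ => (x.1, 2 * Real.pi - x.2.1, x.2.2)) boxMeasure boxMeasure := by
  have h1 : MeasurePreserving (fun θ : ℝ => 2 * Real.pi - θ)
      (volume.restrict (Set.Ico 0 (2 * Real.pi))) (volume.restrict (Set.Ico 0 (2 * Real.pi))) := by
    -- The reflection maps the half-open interval to one open at the other end; the open interval,
    -- equal up to a null set, is preserved exactly.
    rw [Measure.restrict_congr_set Ioo_ae_eq_Ico.symm]
    have h := (Measure.measurePreserving_sub_left (volume : Measure ℝ)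
      (2 * Real.pi)).restrict_preimage (measurableSet_Ioo (a := 0) (b := 2 * Real.pi))
    simpa using h
  rw [boxMeasure_eq_prod]
  exact (MeasurePreserving.id _).prod (h1.prod (MeasurePreserving.id _))

/-- In polar coordinates conjugation is the reflection of `θ`, on which the density does not depend.
-/
theorem measurePreserving_star (w : ℝ → ℝ) (hw : Measurable w) :
    MeasurePreserving (star : ℍ → ℍ) (polarMeasure w) (polarMeasure w) := by
  have hstar : Measurable (star : ℍ → ℍ) := continuous_star.measurable
  refine ⟨hstar, ?_⟩
  set ρ : ℝ × ℝ × ℝ × ℝ → ℝ × ℝ × ℝ × ℝ := fun x => (x.1, 2 * Real.pi - x.2.1, x.2.2) with hρ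
  have hρm : Measurable ρ := measurePreserving_reflect.measurable
  have hcomp : (star : ℍ → ℍ) ∘ polar = polar ∘ ρ := by
    funext x
    simp only [Function.comp_apply]
    ext
    · simp only [Quaternion.re_star]
      simp [polar, hρ]
    · simp only [Quaternion.imI_star]
      simp [polar, hρ]
    · simp only [Quaternion.imJ_star]
      simp [polar, hρ]
    · simp only [Quaternion.imK_star]
      simp [polar, hρ]
  have hν : (boxMeasure.withDensity (polarDensity w)).map ρ =
      boxMeasure.withDensity (polarDensity w) := by
    refine Measure.ext fun s hs => ?_
    rw [Measure.map_apply hρm hs, withDensity_apply _ (hρm hs), withDensity_apply _ hs]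
    exact measurePreserving_reflect.setLIntegral_comp_preimage hs (measurable_polarDensity hw)
  rw [polarMeasure_def, Measure.map_map hstar measurable_polar, hcomp,
    ← Measure.map_map measurable_polar hρm, hν]

end Polar

/-! ### Slice regular functions and complex analysis -/

section Slice

theorem norm_eq_one_of_mul_self {I : ℍ} (hI : I * I = -1) : ‖I‖ = 1 := by
  have h := congrArg norm hI
  rw [norm_mul, norm_neg, norm_one] at h
  nlinarith [norm_nonneg I]

theorem star_eq_neg_of_mul_self {I : ℍ} (hI : I * I = -1) : star I = -I := by
  have h1 : star I * I = 1 := by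
    rw [Quaternion.star_mul_self, Quaternion.normSq_eq_norm_mul_self, norm_eq_one_of_mul_self hI]
    simp
  have h2 : star I * I * I = I := by rw [h1, one_mul]
  rw [mul_assoc, hI, mul_neg_one] at h2
  exact neg_eq_iff_eq_neg.1 h2

/-- The embedding of the complex plane into the quaternions that takes `i` to `I`. -/
def sliceMap {I : ℍ} (hI : I * I = -1) : ℂ →ₐ[ℝ] ℍ := Complex.liftAux I hI

variable {I : ℍ} (hI : I * I = -1)

theorem sliceMap_apply (z : ℂ) : sliceMap hI z = (z.re : ℍ) + z.im • I :=
  Complex.liftAux_apply I hI z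

theorem sliceMap_ofReal (x : ℝ) : sliceMap hI x = (x : ℍ) := by
  simp

theorem star_sliceMap (z : ℂ) : star (sliceMap hI z) = sliceMap hI (starRingEnd ℂ z) := by
  simp [sliceMap_apply, star_eq_neg_of_mul_self hI]

theorem continuous_sliceMap : Continuous (sliceMap hI) :=
  (sliceMap hI).toLinearMap.continuous_of_finiteDimensional

/-- The complex linear functional on the quaternions, as a left vector space over the slice of `I`,
with the given real part. -/
def sliceFunctional (l : ℍ →L[ℝ] ℝ) (I : ℍ) : ℍ →L[ℝ] ℂ :=
  Complex.ofRealCLM ∘L l - Complex.I • (Complex.ofRealCLM ∘L l ∘L ContinuousLinearMap.mul ℝ ℍ I)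

theorem sliceFunctional_apply (l : ℍ →L[ℝ] ℝ) (I h : ℍ) :
    sliceFunctional l I h = l h - Complex.I * l (I * h) := by
  simp [sliceFunctional]

theorem re_sliceFunctional (l : ℍ →L[ℝ] ℝ) (I h : ℍ) : (sliceFunctional l I h).re = l h := by
  simp [sliceFunctional_apply]

theorem sliceFunctional_mul (l : ℍ →L[ℝ] ℝ) (z : ℂ) (h : ℍ) :
    sliceFunctional l I (sliceMap hI z * h) = z * sliceFunctional l I h := by
  have h1 : I * (sliceMap hI z * h) = z.re • (I * h) - z.im • h := by
    rw [sliceMap_apply, ← mul_assoc, mul_add, add_mul, mul_smul_comm, hI,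
      ← Quaternion.coe_commutes, Quaternion.coe_mul_eq_smul, smul_mul_assoc, smul_mul_assoc,
      neg_one_mul, smul_neg, sub_eq_add_neg]
  have h2 : sliceMap hI z * h = z.re • h + z.im • (I * h) := by
    rw [sliceMap_apply, add_mul, Quaternion.coe_mul_eq_smul, smul_mul_assoc]
  rw [sliceFunctional_apply, sliceFunctional_apply, h1, h2]
  simp only [map_add, map_sub, map_smul, smul_eq_mul]
  apply Complex.ext <;> simp
  ring

/-- Left slice regularity is the Cauchy-Riemann equation for left multiplication by `I`. The
functional turns that multiplication into multiplication by `i`, so its composite with `f` is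
entire. -/
theorem differentiable_sliceFunctional {f : ℍ → ℍ} (hf : IsSliceRegular f) (l : ℍ →L[ℝ] ℝ) :
    Differentiable ℂ fun z => sliceFunctional l I (f (sliceMap hI z)) := by
  obtain ⟨h1, h2⟩ := hf I hI
  intro z
  set F : ℝ × ℝ → ℍ := fun z => f ((z.1 : ℍ) + z.2 • I)
  have h3 : HasFDerivAt (fun z => sliceFunctional l I (f (sliceMap hI z)))
      (sliceFunctional l I ∘L fderiv ℝ F (z.re, z.im) ∘L
        (Complex.equivRealProdCLM : ℂ →L[ℝ] ℝ × ℝ)) z := by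
    have h4 := ((sliceFunctional l I).hasFDerivAt.comp (z.re, z.im)
      (h1 (z.re, z.im)).hasFDerivAt).comp z
      (Complex.equivRealProdCLM : ℂ →L[ℝ] ℝ × ℝ).hasFDerivAt
    refine h4.congr_of_eventuallyEq (Eventually.of_forall fun w => ?_)
    simp [F, sliceMap_apply]
  rw [differentiableAt_complex_iff_differentiableAt_real]
  refine ⟨h3.differentiableAt, ?_⟩
  rw [h3.fderiv]
  have h5 : fderiv ℝ F (z.re, z.im) (0, 1) = sliceMap hI Complex.I * fderiv ℝ F (z.re, z.im) (1, 0) := by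
    have h6 := congrArg (I * ·) (h2 (z.re, z.im))
    simp only [mul_add, ← mul_assoc, hI, neg_one_mul, mul_zero] at h6
    rw [show sliceMap hI Complex.I = I by simp [sliceMap_apply]]
    exact (sub_eq_zero.1 (by rw [sub_eq_add_neg]; exact h6)).symm
  simp [h5, sliceFunctional_mul]

/-- Ties the complex derivatives on a slice to the real ones that define `taylorCoeff`. -/
theorem iteratedDeriv_re_ofReal {g : ℂ → ℂ} (hg : Differentiable ℂ g) (n : ℕ) :
    iteratedDeriv n (fun x : ℝ => (g x).re) = fun x : ℝ => (iteratedDeriv n g x).re := by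
  induction n with
  | zero => simp
  | succ n ih =>
    funext x
    rw [iteratedDeriv_succ, ih, iteratedDeriv_succ]
    have h : Differentiable ℂ (iteratedDeriv n g) :=
      (hg.contDiff (n := ⊤)).differentiable_iteratedDeriv n (by simp)
    exact (h x).hasDerivAt.real_of_complex.deriv

/-- On the circle the conjugate of `z` equals `r ^ 2 / z`, so this is Cauchy's integral for the
`n`-th derivative at the centre. -/
theorem integral_conj_pow_mul {g : ℂ → ℂ} (hg : Differentiable ℂ g) (n : ℕ) {r : ℝ} (hr : 0 < r) :
    ∫ θ : ℝ in Set.Ico 0 (2 * Real.pi), (starRingEnd ℂ (circleMap 0 r θ)) ^ n *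
      g (circleMap 0 r θ) = 2 * Real.pi * r ^ (2 * n) * (iteratedDeriv n g 0 / n.factorial) := by
  obtain ⟨R, rfl⟩ : ∃ R : NNReal, (R : ℝ) = r := ⟨⟨r, hr.le⟩, rfl⟩
  have h1 := hg.hasFPowerSeriesOnBall 0 (R := R) (by exact_mod_cast hr)
  have h2 := h1.factorial_smul 1 n
  rw [← iteratedDeriv_eq_iteratedFDeriv, cauchyPowerSeries_apply, nsmul_eq_mul,
    circleIntegral, intervalIntegral.integral_of_le (by positivity),
    ← integral_Ico_eq_integral_Ioc] at h2
  have hr' : ((R : ℝ) : ℂ) ≠ 0 := by exact_mod_cast hr.ne'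
  have h3 : ∀ θ : ℝ, (starRingEnd ℂ (circleMap 0 R θ)) ^ n * g (circleMap 0 R θ) =
      (((R : ℝ) : ℂ) ^ (2 * n) * Complex.I⁻¹) * (deriv (circleMap 0 R) θ •
        (1 / (circleMap 0 R θ - 0)) ^ n • (circleMap 0 R θ - 0)⁻¹ • g (circleMap 0 R θ)) := by
    intro θ
    have hz : circleMap 0 R θ ≠ 0 := circleMap_ne_center hr.ne'
    have hc : starRingEnd ℂ (circleMap 0 R θ) = ((R : ℝ) : ℂ) ^ 2 / circleMap 0 R θ := by
      rw [eq_div_iff hz, mul_comm, Complex.mul_conj, Complex.normSq_eq_norm_sq, norm_circleMap_zero,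
        sq_abs]
      push_cast
      rfl
    rw [hc, deriv_circleMap, sub_zero, smul_eq_mul, smul_eq_mul, smul_eq_mul]
    rw [div_pow, ← pow_mul, one_div, inv_pow]
    field_simp
  simp only [h3]
  rw [integral_const_mul, ← h2]
  have : (n.factorial : ℂ) ≠ 0 := by exact_mod_cast n.factorial_ne_zero
  simp only [smul_eq_mul]
  field_simp

/-- The real coordinate functions of the quaternions. -/
def coordinate : Fin 4 → ℍ →L[ℝ] ℝ :=
  ![LinearMap.toContinuousLinearMap (QuaternionAlgebra.reₗ (-1) 0 (-1)),
    LinearMap.toContinuousLinearMap (QuaternionAlgebra.imIₗ (-1) 0 (-1)),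
    LinearMap.toContinuousLinearMap (QuaternionAlgebra.imJₗ (-1) 0 (-1)),
    LinearMap.toContinuousLinearMap (QuaternionAlgebra.imKₗ (-1) 0 (-1))]

theorem ext_coordinate {a b : ℍ} (h : ∀ i, coordinate i a = coordinate i b) : a = b :=
  QuaternionAlgebra.ext (h 0) (h 1) (h 2) (h 3)

/-- The Taylor coefficients at `0` of a slice regular function. -/
def taylorCoeff (f : ℍ → ℍ) (n : ℕ) : ℍ :=
  let c i := iteratedDeriv n (fun x : ℝ => coordinate i (f x)) 0 / n.factorial
  ⟨c 0, c 1, c 2, c 3⟩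

theorem coordinate_taylorCoeff (f : ℍ → ℍ) (n : ℕ) (i : Fin 4) : coordinate i (taylorCoeff f n) =
    iteratedDeriv n (fun x : ℝ => coordinate i (f x)) 0 / n.factorial := by
  fin_cases i <;> rfl

theorem continuous_slice {f : ℍ → ℍ} (hf : IsSliceRegular f) :
    Continuous fun z => f (sliceMap hI z) := by
  have h := (hf I hI).1.continuous.comp Complex.equivRealProdCLM.continuous
  refine h.congr fun z => ?_
  simp [sliceMap_apply]

theorem integrableOn_slice {f : ℍ → ℍ} (hf : IsSliceRegular f) (n : ℕ) (r : ℝ) :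
    IntegrableOn (fun θ : ℝ => star (sliceMap hI (circleMap 0 r θ)) ^ n *
      f (sliceMap hI (circleMap 0 r θ))) (Set.Ico 0 (2 * Real.pi)) := by
  have h1 := (continuous_slice hI hf).comp (continuous_circleMap 0 r)
  have h2 := (continuous_sliceMap hI).comp (continuous_circleMap 0 r)
  have h3 : Continuous fun θ : ℝ => star (sliceMap hI (circleMap 0 r θ)) ^ n *
      f (sliceMap hI (circleMap 0 r θ)) := (h2.star.pow n).mul h1
  exact (h3.integrableOn_Icc (a := 0) (b := 2 * Real.pi)).mono_set Set.Ico_subset_Icc_self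

theorem sliceFunctional_integral {f : ℍ → ℍ} (hf : IsSliceRegular f) (n : ℕ) {r : ℝ} (hr : 0 < r)
    (l : ℍ →L[ℝ] ℝ) :
    sliceFunctional l I (∫ θ : ℝ in Set.Ico 0 (2 * Real.pi),
      star (sliceMap hI (circleMap 0 r θ)) ^ n * f (sliceMap hI (circleMap 0 r θ))) =
      2 * Real.pi * r ^ (2 * n) *
        (iteratedDeriv n (fun z => sliceFunctional l I (f (sliceMap hI z))) 0 / n.factorial) := by
  rw [← ContinuousLinearMap.integral_comp_comm _ (integrableOn_slice hI hf n r),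
    ← integral_conj_pow_mul (differentiable_sliceFunctional hI hf l) n hr]
  refine integral_congr_ae (Eventually.of_forall fun θ => ?_)
  simp only [star_sliceMap, ← map_pow, sliceFunctional_mul]

/-- The circle integrals of a slice regular function do not depend on the slice. -/
theorem integral_slice {f : ℍ → ℍ} (hf : IsSliceRegular f) (n : ℕ) {r : ℝ} (hr : 0 < r) :
    ∫ θ : ℝ in Set.Ico 0 (2 * Real.pi), star (sliceMap hI (circleMap 0 r θ)) ^ n *
      f (sliceMap hI (circleMap 0 r θ)) = (2 * Real.pi * r ^ (2 * n)) • taylorCoeff f n := by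
  refine ext_coordinate fun i => ?_
  have h := congrArg Complex.re (sliceFunctional_integral hI hf n hr (coordinate i))
  -- The slices share the real axis, so the real part of this derivative at `0` involves only `f` on
  -- the reals and no choice of `I`.
  have h1 := congrFun (iteratedDeriv_re_ofReal
    (differentiable_sliceFunctional hI hf (coordinate i)) n) 0
  simp only [re_sliceFunctional, sliceMap_ofReal, Complex.ofReal_zero] at h1
  rw [re_sliceFunctional] at h
  rw [h, map_smul, coordinate_taylorCoeff, h1, smul_eq_mul]
  have h2 : ∀ w : ℂ, (2 * (Real.pi : ℂ) * (r : ℂ) ^ (2 * n) * (w / (n.factorial : ℂ))).re =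
      2 * Real.pi * r ^ (2 * n) * (w.re / n.factorial) := by
    intro w
    have : (2 * (Real.pi : ℂ) * (r : ℂ) ^ (2 * n) * (w / (n.factorial : ℂ))) =
        ((2 * Real.pi * r ^ (2 * n) / n.factorial : ℝ) : ℂ) * w := by
      push_cast
      ring
    rw [this, Complex.re_ofReal_mul]
    ring
  rw [h2]

/-- The purely imaginary quaternion with the given coordinates. -/
def imaginary (a b c : ℝ) : ℍ := ⟨0, a, b, c⟩

theorem re_imaginary (a b c : ℝ) : (imaginary a b c).re = 0 := rfl

theorem imI_imaginary (a b c : ℝ) : (imaginary a b c).imI = a := rfl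

theorem imJ_imaginary (a b c : ℝ) : (imaginary a b c).imJ = b := rfl

theorem imK_imaginary (a b c : ℝ) : (imaginary a b c).imK = c := rfl

theorem imaginary_mul_self {a b c : ℝ} (h : a ^ 2 + b ^ 2 + c ^ 2 = 1) :
    imaginary a b c * imaginary a b c = -1 := by
  apply Quaternion.ext <;> simp only [Quaternion.re_mul, Quaternion.imI_mul, Quaternion.imJ_mul,
    Quaternion.imK_mul, Quaternion.re_neg, Quaternion.imI_neg, Quaternion.imJ_neg,
    Quaternion.imK_neg, Quaternion.re_one, Quaternion.imI_one, Quaternion.imJ_one,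
    Quaternion.imK_one, re_imaginary, imI_imaginary, imJ_imaginary, imK_imaginary]
  · linear_combination -h
  all_goals ring

theorem exists_slice (q : ℍ) : ∃ (I : ℍ) (hI : I * I = -1) (z : ℂ), q = sliceMap hI z := by
  set s := √(q.imI ^ 2 + q.imJ ^ 2 + q.imK ^ 2) with hs
  have hs2 : s ^ 2 = q.imI ^ 2 + q.imJ ^ 2 + q.imK ^ 2 := Real.sq_sqrt (by positivity)
  by_cases h0 : s = 0
  · refine ⟨_, imaginary_mul_self (a := 1) (b := 0) (c := 0) (by norm_num), (q.re : ℂ), ?_⟩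
    rw [h0] at hs2
    rw [sliceMap_ofReal]
    have h1 : q.imI = 0 := by nlinarith [sq_nonneg q.imI, sq_nonneg q.imJ, sq_nonneg q.imK]
    have h2 : q.imJ = 0 := by nlinarith [sq_nonneg q.imI, sq_nonneg q.imJ, sq_nonneg q.imK]
    have h3 : q.imK = 0 := by nlinarith [sq_nonneg q.imI, sq_nonneg q.imJ, sq_nonneg q.imK]
    ext <;> simp [h1, h2, h3]
  · refine ⟨_, imaginary_mul_self (a := q.imI / s) (b := q.imJ / s) (c := q.imK / s) ?_,
      ⟨q.re, s⟩, ?_⟩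
    · field_simp
      linarith
    · rw [sliceMap_apply]
      apply Quaternion.ext <;> simp [re_imaginary, imI_imaginary, imJ_imaginary, imK_imaginary] <;>
        field_simp

/-- Every point lies on a slice, where each coordinate of `f` is the real part of an entire
function. The circle integrals show that all its derivatives at `0` vanish. -/
theorem eq_zero_of_taylorCoeff_eq_zero {f : ℍ → ℍ} (hf : IsSliceRegular f)
    (h0 : ∀ n, taylorCoeff f n = 0) (q : ℍ) : f q = 0 := by
  obtain ⟨I, hI, z, rfl⟩ := exists_slice q
  refine ext_coordinate fun i => ?_
  set g := fun z => sliceFunctional (coordinate i) I (f (sliceMap hI z)) with hg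
  have hd : Differentiable ℂ g := differentiable_sliceFunctional hI hf _
  have h1 : ∀ n, iteratedDeriv n g 0 = 0 := by
    intro n
    have h := sliceFunctional_integral hI hf n one_pos (coordinate i)
    rw [integral_slice hI hf n one_pos, h0, smul_zero, map_zero] at h
    have h1 : (2 * Real.pi * (1 : ℝ) ^ (2 * n) : ℂ) ≠ 0 := by
      simp [Real.pi_ne_zero]
    have h2 : (n.factorial : ℂ) ≠ 0 := by exact_mod_cast n.factorial_ne_zero
    exact (div_eq_zero_iff.1 ((mul_eq_zero.1 h.symm).resolve_left h1)).resolve_right h2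
  have h2 := Complex.hasSum_taylorSeries_of_entire hd 0 z
  simp only [h1, smul_zero] at h2
  have h3 : g z = 0 := h2.unique hasSum_zero
  rw [map_zero, ← re_sliceFunctional _ I, ← Complex.zero_re, ← h3]

theorem sphere_mul_self (y : ℝ × ℝ) :
    imaginary (Real.sin y.1 * Real.cos y.2) (Real.sin y.1 * Real.sin y.2) (Real.cos y.1) *
      imaginary (Real.sin y.1 * Real.cos y.2) (Real.sin y.1 * Real.sin y.2) (Real.cos y.1) =
        -1 := by
  refine imaginary_mul_self ?_
  linear_combination Real.sin_sq_add_cos_sq y.1 +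
    Real.sin y.1 ^ 2 * Real.sin_sq_add_cos_sq y.2

theorem polar_eq_sliceMap (r θ : ℝ) (y : ℝ × ℝ) :
    polar (r, θ, y) = sliceMap (sphere_mul_self y) (circleMap 0 r θ) := by
  have h1 : (circleMap 0 r θ).re = r * Real.cos θ := by
    simp [circleMap, Complex.exp_ofReal_mul_I_re]
  have h2 : (circleMap 0 r θ).im = r * Real.sin θ := by
    simp [circleMap, Complex.exp_ofReal_mul_I_im]
  rw [sliceMap_apply, h1, h2]
  apply Quaternion.ext <;> simp [polar, re_imaginary, imI_imaginary, imJ_imaginary,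
    imK_imaginary] <;> ring

/-- The pairing of a power with a slice regular function. -/
theorem integral_star_pow_mul {f : ℍ → ℍ} (hf : IsSliceRegular f) (n : ℕ)
    (hint : Integrable (fun q => star (q ^ n) * f q) gaussMeasure) :
    ∫ q, star (q ^ n) * f q ∂gaussMeasure = (n.factorial : ℝ) • taylorCoeff f n := by
  have hw : Measurable fun r : ℝ => r * Real.exp (-r ^ 2) := by fun_prop
  have hpow : Integrable (fun q : ℍ => ‖q‖ ^ (2 * n)) gaussMeasure :=
    .of_integral_ne_zero (by rw [integral_norm_pow]; exact_mod_cast n.factorial_ne_zero)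
  rw [← integral_norm_pow, ← integral_smul_const]
  refine integral_polarMeasure_congr hw hint (hpow.smul_const _) fun r hr y => ?_
  simp only [norm_polar, abs_of_pos hr, setIntegral_const, star_pow]
  simp only [polar_eq_sliceMap]
  rw [integral_slice _ hf n hr]
  simp [Real.pi_pos.le, smul_smul]

end Slice

/-! ### Power series and the coordinates of the Bargmann space -/

section PowerSeries

/-- With `x` the absolute value of the term, `2 * x ≤ 2 ^ n * x ^ 2 + 1 / 2 ^ n`, and the right side
sums to an exponential plus a geometric series. -/
theorem summable_pow_div_sqrt_factorial (R : ℝ) :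
    Summable fun n : ℕ => R ^ n / √(n.factorial : ℝ) := by
  have h1 := ((Real.summable_pow_div_factorial (2 * R ^ 2)).add
    (summable_geometric_of_lt_one (r := (1 / 2 : ℝ)) (by norm_num) (by norm_num))).mul_left (1 / 2)
  refine Summable.of_norm_bounded h1 fun n => ?_
  rw [Real.norm_eq_abs, abs_div, abs_of_nonneg (Real.sqrt_nonneg _)]
  set x := |R ^ n| / √(n.factorial : ℝ) with hx
  have hx2 : x ^ 2 = (R ^ 2) ^ n / n.factorial := by
    rw [hx, div_pow, Real.sq_sqrt (by positivity), sq_abs]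
    ring
  have h2 : (2 * R ^ 2) ^ n / n.factorial = 2 ^ n * x ^ 2 := by
    rw [hx2, mul_pow]
    ring
  rw [h2, one_div_pow]
  have h3 : (0 : ℝ) < 2 ^ n := by positivity
  have h4 : 1 / 2 * (2 ^ n * x ^ 2 + 1 / 2 ^ n) - x = (2 ^ n * x - 1) ^ 2 / (2 * 2 ^ n) := by
    field_simp
    ring
  have h5 : 0 ≤ (2 ^ n * x - 1) ^ 2 / (2 * 2 ^ n) := by positivity
  linarith

theorem differentiable_tsum_pow_mul {b : ℕ → ℂ} (hb : ∀ R : ℝ, Summable fun n => R ^ n * ‖b n‖) :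
    Differentiable ℂ fun z : ℂ => ∑' n, z ^ n * b n := by
  intro z
  have h := Complex.differentiableOn_tsum_of_summable_norm (F := fun n (z : ℂ) => z ^ n * b n)
    (U := Metric.ball 0 (‖z‖ + 1)) (hb (‖z‖ + 1))
    (fun n => ((differentiable_id.pow n).mul_const (b n)).differentiableOn) Metric.isOpen_ball
    (fun n w hw => by
      rw [norm_mul, norm_pow]
      gcongr
      exact (mem_ball_zero_iff.1 hw).le)
  exact h.differentiableAt (Metric.isOpen_ball.mem_nhds (by simp))

/-- A power series with real coefficients maps each slice into itself, so there it is an ordinary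
entire function transported by `sliceMap`. -/
theorem isSliceRegular_tsum_coe {b : ℕ → ℝ} (hb : ∀ R : ℝ, Summable fun n => R ^ n * |b n|) :
    IsSliceRegular fun q => ∑' n, q ^ n * (b n : ℍ) := by
  intro I hI
  set G : ℂ → ℂ := fun z => ∑' n, z ^ n * (b n : ℂ) with hG
  have hd : Differentiable ℂ G := differentiable_tsum_pow_mul (by simpa using hb)
  let ι : ℂ →L[ℝ] ℍ := LinearMap.toContinuousLinearMap (sliceMap hI).toLinearMap
  have hι : ∀ z, ι z = sliceMap hI z := fun z => rfl
  have hsum : ∀ z : ℂ, Summable fun n => z ^ n * (b n : ℂ) := fun z =>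
    Summable.of_norm_bounded (hb ‖z‖) fun n => by simp
  have heq : (fun z : ℝ × ℝ => ∑' n, ((z.1 : ℍ) + z.2 • I) ^ n * (b n : ℍ)) =
      fun z => ι (G (Complex.equivRealProdCLM.symm z)) := by
    funext z
    rw [hG, ι.map_tsum (hsum _)]
    refine tsum_congr fun n => ?_
    rw [hι, map_mul, map_pow, sliceMap_ofReal, sliceMap_apply]
    simp
  have hF : ∀ z : ℝ × ℝ, HasFDerivAt (fun z => ι (G (Complex.equivRealProdCLM.symm z)))
      (ι ∘L ((fderiv ℂ G (Complex.equivRealProdCLM.symm z)).restrictScalars ℝ) ∘L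
        (Complex.equivRealProdCLM.symm : ℝ × ℝ →L[ℝ] ℂ)) z := fun z =>
    ι.hasFDerivAt.comp z (((hd _).hasFDerivAt.restrictScalars ℝ).comp z
      (Complex.equivRealProdCLM.symm : ℝ × ℝ →L[ℝ] ℂ).hasFDerivAt)
  simp only [heq]
  refine ⟨fun z => (hF z).differentiableAt, fun z => ?_⟩
  rw [(hF z).fderiv]
  set L := fderiv ℂ G (Complex.equivRealProdCLM.symm z)
  have h1 : Complex.equivRealProdCLM.symm ((1, 0) : ℝ × ℝ) = 1 := by
    apply Complex.ext <;> simp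
  have h2 : Complex.equivRealProdCLM.symm ((0, 1) : ℝ × ℝ) = Complex.I := by
    apply Complex.ext <;> simp
  have h3 : L Complex.I = Complex.I * L 1 := by
    rw [← smul_eq_mul, ← map_smul, smul_eq_mul, mul_one]
  have h4 : sliceMap hI Complex.I = I := by simp [sliceMap_apply]
  simp only [ContinuousLinearMap.comp_apply, ContinuousLinearEquiv.coe_coe,
    ContinuousLinearMap.coe_restrictScalars', h1, h2, h3, hι, map_mul, h4]
  rw [← mul_assoc, hI, neg_one_mul, add_neg_cancel]

theorem summable_pow_mul {b : ℕ → ℍ} (hb : ∀ R : ℝ, Summable fun n => R ^ n * ‖b n‖) (q : ℍ) :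
    Summable fun n => q ^ n * b n :=
  Summable.of_norm_bounded (hb ‖q‖) fun n => by simp

/-- Split each coefficient into four real components. The units `1`, `i`, `j`, `k` stand to the
right of the powers, and right multiplication by constants preserves slice regularity. -/
theorem isSliceRegular_tsum {b : ℕ → ℍ} (hb : ∀ R : ℝ, Summable fun n => R ^ n * ‖b n‖) :
    IsSliceRegular fun q => ∑' n, q ^ n * b n := by
  have hc : ∀ c : ℕ → ℝ, (∀ n, |c n| ≤ ‖b n‖) → ∀ R : ℝ, Summable fun n => R ^ n * |c n| := by
    intro c hc R
    refine Summable.of_norm_bounded (hb |R|) fun n => ?_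
    rw [norm_mul, norm_pow, Real.norm_eq_abs, Real.norm_eq_abs, abs_abs]
    gcongr
    exact hc n
  have hn : ∀ h : ℍ, h.re ^ 2 + h.imI ^ 2 + h.imJ ^ 2 + h.imK ^ 2 = ‖h‖ ^ 2 := by
    intro h
    rw [sq ‖h‖, ← Quaternion.normSq_eq_norm_mul_self, Quaternion.normSq_def']
  have h0 : ∀ n, |(b n).re| ≤ ‖b n‖ := fun n => abs_le_of_sq_le_sq (by
    nlinarith [hn (b n), sq_nonneg (b n).imI, sq_nonneg (b n).imJ, sq_nonneg (b n).imK])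
    (norm_nonneg _)
  have h1 : ∀ n, |(b n).imI| ≤ ‖b n‖ := fun n => abs_le_of_sq_le_sq (by
    nlinarith [hn (b n), sq_nonneg (b n).re, sq_nonneg (b n).imJ, sq_nonneg (b n).imK])
    (norm_nonneg _)
  have h2 : ∀ n, |(b n).imJ| ≤ ‖b n‖ := fun n => abs_le_of_sq_le_sq (by
    nlinarith [hn (b n), sq_nonneg (b n).imI, sq_nonneg (b n).re, sq_nonneg (b n).imK])
    (norm_nonneg _)
  have h3 : ∀ n, |(b n).imK| ≤ ‖b n‖ := fun n => abs_le_of_sq_le_sq (by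
    nlinarith [hn (b n), sq_nonneg (b n).imI, sq_nonneg (b n).imJ, sq_nonneg (b n).re])
    (norm_nonneg _)
  have hs : ∀ c : ℕ → ℝ, (∀ n, |c n| ≤ ‖b n‖) → ∀ q : ℍ, Summable fun n => q ^ n * (c n : ℍ) :=
    fun c h q => summable_pow_mul (by simpa using hc c h) q
  have hdec : ∀ h : ℍ, h = (h.re : ℍ) + (h.imI : ℍ) * imaginary 1 0 0 +
      (h.imJ : ℍ) * imaginary 0 1 0 + (h.imK : ℍ) * imaginary 0 0 1 := by
    intro h
    apply Quaternion.ext <;> simp [re_imaginary, imI_imaginary, imJ_imaginary, imK_imaginary]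
  convert (((isSliceRegular_tsum_coe (hc _ h0)).add
    ((isSliceRegular_tsum_coe (hc _ h1)).mul_const (imaginary 1 0 0))).add
    ((isSliceRegular_tsum_coe (hc _ h2)).mul_const (imaginary 0 1 0))).add
    ((isSliceRegular_tsum_coe (hc _ h3)).mul_const (imaginary 0 0 1)) using 1
  funext q
  rw [← (hs _ h1 q).tsum_mul_right, ← (hs _ h2 q).tsum_mul_right, ← (hs _ h3 q).tsum_mul_right,
    ← (hs _ h0 q).tsum_add ((hs _ h1 q).mul_right _),
    ← ((hs _ h0 q).add ((hs _ h1 q).mul_right _)).tsum_add ((hs _ h2 q).mul_right _),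
    ← (((hs _ h0 q).add ((hs _ h1 q).mul_right _)).add ((hs _ h2 q).mul_right _)).tsum_add
      ((hs _ h3 q).mul_right _)]
  refine tsum_congr fun n => ?_
  nth_rewrite 1 [hdec (b n)]
  simp only [mul_add, mul_assoc]

end PowerSeries

/-! ### The orthonormal basis and completeness of the Bargmann space -/

section Pairing

/-- The quaternionic scalar product of square integrable functions. -/
def pairing (F G : L2) : ℍ := ∫ x, star (F x) * G x ∂gaussMeasure

theorem integrable_pairing (F G : L2) :
    Integrable (fun x => star (F x) * G x) gaussMeasure :=
  MemLp.integrable_mul (Lp.memLp F).star (Lp.memLp G)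

/-- Quaternionic conjugation as a real linear map. -/
def starMap : ℍ →L[ℝ] ℍ := LinearMap.toContinuousLinearMap
  { toFun := star
    map_add' := star_add
    map_smul' := fun r q => Quaternion.star_smul r q }

theorem starMap_apply (q : ℍ) : starMap q = star q := rfl

theorem star_pairing (F G : L2) : star (pairing F G) = pairing G F := by
  have h := starMap.integral_comp_comm (integrable_pairing F G)
  refine h.symm.trans (integral_congr_ae (Eventually.of_forall fun x => ?_))
  simp only [starMap_apply, star_mul, star_star]

theorem pairing_add (F G G' : L2) : pairing F (G + G') = pairing F G + pairing F G' := by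
  rw [pairing, pairing, pairing, ← integral_add (integrable_pairing F G) (integrable_pairing F G')]
  refine integral_congr_ae ?_
  filter_upwards [Lp.coeFn_add G G'] with x h1
  rw [h1, Pi.add_apply, mul_add]

theorem pairing_smul (F G : L2) (q : ℍ) : pairing F (G <• q) = pairing F G * q := by
  rw [pairing, pairing, ← integral_mul_const_of_integrable (integrable_pairing F G)]
  refine integral_congr_ae ?_
  filter_upwards [Lp.coeFn_smul (MulOpposite.op q) G] with x h1
  rw [h1, Pi.smul_apply, MulOpposite.smul_eq_mul_unop, MulOpposite.unop_op, mul_assoc]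

theorem smul_pairing (F G : L2) (q : ℍ) : pairing (F <• q) G = star q * pairing F G := by
  rw [← star_pairing, pairing_smul, star_mul, star_pairing]

theorem inner_eq_re_pairing (F G : L2) : inner ℝ F G = (pairing F G).re := by
  have h := (coordinate 0).integral_comp_comm (integrable_pairing F G)
  rw [L2.inner_def]
  refine (integral_congr_ae (Eventually.of_forall fun x => ?_)).trans h
  change inner ℝ (F x) (G x) = (star (F x) * G x).re
  simp only [Quaternion.inner_def, Quaternion.re_mul, Quaternion.re_star, Quaternion.imI_star,
    Quaternion.imJ_star, Quaternion.imK_star]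
  ring

theorem norm_smul_L2_le (F : L2) (q : ℍ) : ‖F <• q‖ ≤ ‖F‖ * ‖q‖ :=
  (norm_smul_le (MulOpposite.op q) F).trans_eq (by rw [MulOpposite.norm_op, mul_comm])

/-- Real Cauchy-Schwarz for `F <• h` and `G`, where `h` is the pairing itself: the real scalar
product becomes `‖h‖ ^ 2`. -/
theorem norm_pairing_le (F G : L2) : ‖pairing F G‖ ≤ ‖F‖ * ‖G‖ := by
  set h := pairing F G with hh
  have h1 : ‖h‖ * ‖h‖ = inner ℝ (F <• h) G := by
    rw [inner_eq_re_pairing, smul_pairing, ← hh, Quaternion.star_mul_self, Quaternion.re_coe,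
      Quaternion.normSq_eq_norm_mul_self]
  have h2 : ‖h‖ * ‖h‖ ≤ ‖F‖ * ‖G‖ * ‖h‖ := by
    rw [h1]
    refine (real_inner_le_norm _ _).trans ?_
    calc _ ≤ ‖F‖ * ‖h‖ * ‖G‖ := by
          gcongr
          exact norm_smul_L2_le F h
      _ = _ := by ring
  rcases (norm_nonneg h).eq_or_lt with h0 | h0
  · rw [← h0]
    positivity
  · exact le_of_mul_le_mul_right h2 h0

/-- The quaternionic scalar product vanishes if all real scalar products with multiples do. -/
theorem pairing_eq_zero_of_inner {F G : L2} (h : ∀ q : ℍ, inner ℝ (F <• q) G = 0) :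
    pairing F G = 0 := by
  have h1 := h (pairing F G)
  rw [inner_eq_re_pairing, smul_pairing, Quaternion.star_mul_self, Quaternion.re_coe] at h1
  exact Quaternion.normSq_eq_zero.1 h1

theorem taylorCoeff_pow (n m : ℕ) : taylorCoeff (fun q => q ^ n) m = if m = n then 1 else 0 := by
  refine ext_coordinate fun i => ?_
  rw [coordinate_taylorCoeff]
  have h : (fun x : ℝ => coordinate i ((x : ℍ) ^ n)) = fun x => x ^ n * coordinate i 1 := by
    funext x
    rw [← Quaternion.coe_pow, ← smul_eq_mul, ← map_smul]
    congr 1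
    rw [← Quaternion.coe_mul_eq_smul, mul_one]
  simp only [h]
  rw [iteratedDeriv_mul_const_field, iteratedDeriv_fun_pow_zero]
  have := m.factorial_ne_zero
  split_ifs with h1
  · subst h1
    field_simp
  · simp

theorem coeFn_basis (n : ℕ) : (Φ n : L2) =ᵐ[gaussMeasure]
    fun q => q ^ n * ((1 / √(n.factorial : ℝ) : ℝ) : ℍ) := by
  have h1 : (Φ n : L2) = (memLp_pow n).toLp _ <• ((1 / √(n.factorial : ℝ) : ℝ) : ℍ) := rfl
  rw [h1]
  filter_upwards [Lp.coeFn_smul (MulOpposite.op ((1 / √(n.factorial : ℝ) : ℝ) : ℍ))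
    ((memLp_pow n).toLp _), (memLp_pow n).coeFn_toLp] with x h2 h3
  rw [h2, Pi.smul_apply, h3, MulOpposite.smul_eq_mul_unop, MulOpposite.unop_op]

theorem pairing_basis {F : L2} {f : ℍ → ℍ} (hf : IsSliceRegular f) (hF : F =ᵐ[gaussMeasure] f)
    (n : ℕ) : pairing (Φ n) F = √(n.factorial : ℝ) • taylorCoeff f n := by
  have h1 : (Φ n : L2) = (memLp_pow n).toLp _ <• ((1 / √(n.factorial : ℝ) : ℝ) : ℍ) := rfl
  have h2 : (fun q => star ((memLp_pow n).toLp (fun x : ℍ => x ^ n) q) * F q)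
      =ᵐ[gaussMeasure] fun q => star (q ^ n) * f q := by
    filter_upwards [(memLp_pow n).coeFn_toLp, hF] with x h3 h4
    rw [h3, h4]
  rw [h1, smul_pairing, pairing, integral_congr_ae h2,
    integral_star_pow_mul hf n ((integrable_pairing _ F).congr h2), Quaternion.star_coe,
    Quaternion.coe_mul_eq_smul, smul_smul]
  congr 1
  rw [one_div_mul_eq_div, Real.div_sqrt]

theorem pairing_basis_basis (m n : ℕ) : pairing (Φ m) (Φ n) = if m = n then 1 else 0 := by
  have h1 : (Φ n : L2) = (memLp_pow n).toLp _ <• ((1 / √(n.factorial : ℝ) : ℝ) : ℍ) := rfl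
  rw [h1, pairing_smul, pairing_basis (isSliceRegular_pow n) (memLp_pow n).coeFn_toLp,
    taylorCoeff_pow]
  split_ifs with h
  · subst h
    have : √(m.factorial : ℝ) ≠ 0 := (Real.sqrt_pos.2 (by positivity)).ne'
    rw [Quaternion.mul_coe_eq_smul, smul_smul, one_div_mul_cancel this, one_smul]
  · simp

/-- The multiples of a basis vector, as a real linear isometry. -/
def basisIsometry (n : ℕ) : ℍ →ₗᵢ[ℝ] L2 where
  toFun h := (Φ n : L2) <• h
  map_add' a b := by rw [MulOpposite.op_add, add_smul]
  map_smul' r a := by rw [MulOpposite.op_smul, smul_assoc, RingHom.id_apply]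
  norm_map' h := by
    refine (sq_eq_sq₀ (norm_nonneg _) (norm_nonneg _)).1 ?_
    rw [← real_inner_self_eq_norm_sq]
    change inner ℝ ((Φ n : L2) <• h) ((Φ n : L2) <• h) = _
    rw [inner_eq_re_pairing, smul_pairing, pairing_smul, pairing_basis_basis, if_pos rfl, one_mul,
      Quaternion.star_mul_self, Quaternion.re_coe, Quaternion.normSq_eq_norm_mul_self, sq]

theorem orthogonalFamily_basis : OrthogonalFamily ℝ (fun _ : ℕ => ℍ) basisIsometry := by
  intro m n hmn a b
  change inner ℝ ((Φ m : L2) <• a) ((Φ n : L2) <• b) = 0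
  rw [inner_eq_re_pairing, smul_pairing, pairing_smul, pairing_basis_basis, if_neg hmn]
  simp

/-- The synthesis map from the square summable sequences. -/
def synthesis : lp (fun _ : ℕ => ℍ) 2 →ₗᵢ[ℝ] L2 := orthogonalFamily_basis.linearIsometry

theorem hasSum_synthesis (a : lp (fun _ : ℕ => ℍ) 2) :
    HasSum (fun n => (Φ n : L2) <• a n) (synthesis a) :=
  orthogonalFamily_basis.hasSum_linearIsometry a

theorem synthesis_ae_eq (a : lp (fun _ : ℕ => ℍ) 2) : IsSliceRegular
      (fun q => ∑' n, q ^ n * ((1 / √(n.factorial : ℝ) : ℝ) • a n)) ∧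
    synthesis a =ᵐ[gaussMeasure] fun q => ∑' n, q ^ n * ((1 / √(n.factorial : ℝ) : ℝ) • a n) := by
  have hb : ∀ R : ℝ, Summable fun n : ℕ => R ^ n * ‖(1 / √(n.factorial : ℝ) : ℝ) • a n‖ := by
    intro R
    refine Summable.of_norm_bounded ((summable_pow_div_sqrt_factorial |R|).mul_right ‖a‖)
      fun n => ?_
    have h := lp.norm_apply_le_norm (by simp) a n
    have h' : ‖(1 / √(n.factorial : ℝ) : ℝ)‖ = 1 / √(n.factorial : ℝ) :=
      Real.norm_of_nonneg (by positivity)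
    rw [norm_mul, norm_norm, norm_smul, h', norm_pow, Real.norm_eq_abs]
    calc _ = |R| ^ n / √(n.factorial : ℝ) * ‖a n‖ := by ring
      _ ≤ _ := by gcongr
  refine ⟨isSliceRegular_tsum hb, ?_⟩
  -- A subsequence of the `L2` partial sums converges almost everywhere. The power series converges
  -- everywhere, so the two limits agree.
  obtain ⟨ns, hns, hae⟩ := (tendstoInMeasure_of_tendsto_Lp
    (hasSum_synthesis a).tendsto_sum_nat).exists_seq_tendsto_ae
  have hpart : ∀ N, (↑(∑ n ∈ Finset.range N, (Φ n : L2) <• a n) : ℍ → ℍ) =ᵐ[gaussMeasure]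
      fun q => ∑ n ∈ Finset.range N, q ^ n * ((1 / √(n.factorial : ℝ) : ℝ) • a n) := by
    intro N
    induction N with
    | zero =>
      simp only [Finset.range_zero, Finset.sum_empty]
      exact Lp.coeFn_zero ℍ 2 gaussMeasure
    | succ N ih =>
      simp only [Finset.sum_range_succ]
      filter_upwards [ih, Lp.coeFn_add (∑ n ∈ Finset.range N, (Φ n : L2) <• a n)
        ((Φ N : L2) <• a N), Lp.coeFn_smul (MulOpposite.op (a N)) (Φ N : L2), coeFn_basis N]
        with q h1 h2 h3 h4
      rw [h2, Pi.add_apply, h1, h3, Pi.smul_apply, h4, MulOpposite.smul_eq_mul_unop,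
        MulOpposite.unop_op, mul_assoc, Quaternion.coe_mul_eq_smul]
  filter_upwards [hae, ae_all_iff.2 hpart] with q h1 h2
  refine tendsto_nhds_unique h1 ?_
  simp only [h2]
  exact (summable_pow_mul hb q).hasSum.tendsto_sum_nat.comp hns.tendsto_atTop

/-- The range of an isometry on a complete space is closed, so any element of the Bargmann space
splits off an orthogonal remainder. That remainder is again slice regular, and all its Taylor
coefficients vanish. -/
theorem range_synthesis : Set.range synthesis = (bargmannSpace : Set L2) := by
  have hsub : ∀ a, synthesis a ∈ bargmannSpace := fun a =>
    ⟨_, (synthesis_ae_eq a).1, (synthesis_ae_eq a).2⟩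
  refine Set.Subset.antisymm (Set.range_subset_iff.2 hsub) fun F hF => ?_
  set K : Submodule ℝ L2 := LinearMap.range synthesis.toLinearMap with hK
  have hcomplete : IsComplete (K : Set L2) := by
    have h : (K : Set L2) = Set.range synthesis := by
      rw [hK, LinearMap.coe_range]
      rfl
    rw [h]
    exact (synthesis.isometry.isClosedEmbedding.isClosed_range).isComplete
  have : CompleteSpace K := hcomplete.completeSpace_coe
  obtain ⟨y, ⟨a, rfl⟩, z, hz, rfl⟩ := Submodule.exists_add_mem_mem_orthogonal (K := K) F
  have hzB : z ∈ bargmannSpace := by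
    have h := bargmannSpace.sub_mem hF (hsub a)
    rwa [show synthesis.toLinearMap a + z - synthesis a = z from add_sub_cancel_left _ _] at h
  obtain ⟨f, hf, hzf⟩ := hzB
  have hc : ∀ n, taylorCoeff f n = 0 := by
    intro n
    have h1 : pairing (Φ n) z = 0 := by
      refine pairing_eq_zero_of_inner fun q => hz _ ⟨lp.single 2 n q, ?_⟩
      refine (hasSum_synthesis (lp.single 2 n q)).unique ?_
      convert hasSum_ite_eq n ((Φ n : L2) <• q) using 2 with m
      split_ifs with h
      · subst h
        simp
      · rw [lp.single_apply_ne _ _ _ h, MulOpposite.op_zero, zero_smul]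
    rw [pairing_basis hf hzf] at h1
    exact (smul_eq_zero.1 h1).resolve_left (Real.sqrt_pos.2 (by positivity)).ne'
  have hz0 : z = 0 := by
    refine Lp.ext ?_
    filter_upwards [hzf, Lp.coeFn_zero ℍ 2 gaussMeasure] with q h1 h2
    rw [h1, h2, eq_zero_of_taylorCoeff_eq_zero hf hc, Pi.zero_apply]
  exact ⟨a, by rw [hz0, add_zero]; rfl⟩

/-- The coordinate functions on the square integrable functions. -/
def basisCoeff (n : ℕ) : L2 →L[ℝ] ℍ :=
  LinearMap.mkContinuous
    { toFun := pairing (Φ n)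
      map_add' := pairing_add _
      map_smul' := fun r F => by
        have h : r • F = F <• (r : ℍ) := by
          rw [← algebraMap_smul ℍᵐᵒᵖ r F]
          rfl
        rw [h, pairing_smul, Quaternion.mul_coe_eq_smul, RingHom.id_apply] }
    ‖(Φ n : L2)‖ (norm_pairing_le _)

theorem basisCoeff_apply (n : ℕ) (F : L2) : basisCoeff n F = pairing (Φ n) F := rfl

theorem pairing_synthesis (a : lp (fun _ : ℕ => ℍ) 2) (n : ℕ) :
    pairing (Φ n) (synthesis a) = a n := by
  refine ((hasSum_synthesis a).mapL (basisCoeff n)).unique ?_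
  convert hasSum_ite_eq n (a n) using 2 with m
  rw [basisCoeff_apply, pairing_smul, pairing_basis_basis]
  by_cases h : m = n
  · subst h
    simp
  · rw [if_neg h, if_neg (Ne.symm h), zero_mul]

theorem exists_synthesis (f : HB) : ∃ a, synthesis a = (f : L2) ∧ ∀ n, qinner (Φ n) f = a n := by
  have h : (f : L2) ∈ Set.range synthesis := by
    rw [range_synthesis]
    exact f.2
  obtain ⟨a, ha⟩ := h
  refine ⟨a, ha, fun n => ?_⟩
  rw [← pairing_synthesis, ha]
  rfl

theorem isClosed_bargmannSpace : IsClosed (bargmannSpace : Set L2) := by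
  rw [← range_synthesis]
  exact synthesis.isometry.isClosedEmbedding.isClosed_range

instance instCompleteSpaceHB : CompleteSpace HB :=
  isClosed_bargmannSpace.isComplete.completeSpace_coe

/-- The coordinates of the Bargmann space with respect to the basis `Φ`. -/
def coords : Coordinates HB where
  coeff n := LinearMap.mkContinuous
    { toFun := qinner (Φ n)
      map_add' := qinner_add _
      map_smul' := fun r f => (basisCoeff n).map_smul r (f : L2) }
    ‖(Φ n : L2)‖ (fun f => norm_pairing_le _ (f : L2))
  ket n := LinearMap.mkContinuous
    { toFun := fun h => Φ n <• h
      map_add' := fun a b => by rw [MulOpposite.op_add, add_smul]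
      map_smul' := fun r a => by rw [MulOpposite.op_smul, smul_assoc, RingHom.id_apply] }
    1 (fun h => (basisIsometry n).norm_map h |>.le.trans_eq (one_mul _).symm)
  coeff_ket m n h := by
    change pairing (Φ m) ((Φ n : L2) <• h) = _
    rw [pairing_smul, pairing_basis_basis]
    split_ifs <;> simp
  parseval f := by
    obtain ⟨a, ha, hc⟩ := exists_synthesis f
    have h1 := lp.hasSum_norm (by simp) a
    have h2 : ‖f‖ = ‖a‖ := by
      rw [← synthesis.norm_map, ha]
      rfl
    simp only [ENNReal.toReal_ofNat, Real.rpow_ofNat] at h1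
    rw [h2]
    exact h1.congr_fun fun n => congrArg (‖·‖ ^ 2) (hc n)

theorem coeff_coords (n : ℕ) (f : HB) : coords.coeff n f = qinner (Φ n) f := rfl

theorem ket_coords (n : ℕ) (h : ℍ) : coords.ket n h = Φ n <• h := rfl

/-- Elements of the Bargmann space are given by their power series. -/
theorem ae_eq_tsum (f : HB) : (f : L2) =ᵐ[gaussMeasure] fun q =>
    ∑' n, q ^ n * ((1 / √(n.factorial : ℝ) : ℝ) • qinner (Φ n) f) := by
  obtain ⟨a, ha, hc⟩ := exists_synthesis f
  simp only [hc, ← ha]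
  exact (synthesis_ae_eq a).2

theorem qinner_basis (m n : ℕ) : qinner (Φ m) (Φ n) = if m = n then 1 else 0 :=
  pairing_basis_basis m n

theorem star_qinner (f g : HB) : star (qinner f g) = qinner g f :=
  star_pairing (f : L2) (g : L2)

theorem smul_qinner (f g : HB) (q : ℍ) : qinner (f <• q) g = star q * qinner f g :=
  smul_pairing (f : L2) (g : L2) q

theorem qinner_smul_right (f g : HB) (q : ℍ) : qinner f (g <• q) = qinner f g * q :=
  pairing_smul (f : L2) (g : L2) q

theorem re_qinner_self (f : HB) : (qinner f f).re = ‖f‖ ^ 2 :=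
  (inner_eq_re_pairing (f : L2) (f : L2)).symm.trans (real_inner_self_eq_norm_sq (f : L2))

theorem add_qinner (f g h : HB) : qinner (f + g) h = qinner f h + qinner g h := by
  rw [← star_qinner, qinner_add, star_add, star_qinner, star_qinner]

/-- An isometric right linear operator preserves the quaternionic scalar product. -/
theorem qinner_map_map {S : HB →L[ℍᵐᵒᵖ] HB} (hS : ∀ f, ‖S f‖ = ‖f‖) (f g : HB) :
    qinner (S f) (S g) = qinner f g := by
  have h1 : ∀ f g, (qinner (S f) (S g)).re = (qinner f g).re := by
    intro f g
    have h2 : ∀ f g : HB, (qinner f g).re = (‖f + g‖ ^ 2 - ‖f‖ ^ 2 - ‖g‖ ^ 2) / 2 := by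
      intro f g
      have h3 : (qinner g f).re = (qinner f g).re := by rw [← star_qinner, Quaternion.re_star]
      simp only [← re_qinner_self, add_qinner, qinner_add, Quaternion.re_add, h3]
      ring
    rw [h2, h2, ← map_add, hS, hS, hS]
  -- Polarization controls only real parts. Replacing `f` by `f <• w` and using right linearity
  -- shows that the real part of `star w * w` is `0`.
  set w := qinner (S f) (S g) - qinner f g with hw
  have h3 : (star w * w).re = 0 := by
    have h4 := h1 (f <• w) g
    rw [map_smul, smul_qinner, smul_qinner] at h4
    rw [hw, mul_sub, Quaternion.re_sub, ← hw, h4, sub_self]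
  rw [Quaternion.star_mul_self, Quaternion.re_coe, Quaternion.normSq_eq_zero] at h3
  exact sub_eq_zero.1 h3

end Pairing

/-! ### The natural domains and the ladder operators -/

section Graphs

theorem summable_ket {h : ℕ → ℍ} (hh : Summable fun n => ‖h n‖ ^ 2) :
    Summable fun n => Φ n <• h n := by
  have h1 : Summable fun n => (Φ n : L2) <• h n :=
    (orthogonalFamily_basis.summable_iff_norm_sq_summable h).2 hh
  have hmem : ∑' n, (Φ n : L2) <• h n ∈ bargmannSpace :=
    isClosed_bargmannSpace.mem_of_tendsto h1.hasSum (Eventually.of_forall fun s =>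
      bargmannSpace.sum_mem fun n _ => (Φ n <• h n).2)
  have h2 : HasSum (fun n => Φ n <• h n) (⟨_, hmem⟩ : HB) :=
    (Topology.IsInducing.subtypeVal.hasSum_iff (g := bargmannSpace.subtype) _ _).1 h1.hasSum
  exact h2.summable

theorem hasSum_ketBraSum {e d : ℕ → HB} {c : ℕ → ℍ} (f : (ketBraSum e c d).domain) :
    HasSum (fun n => e n <• (c n * qinner (d n) (f : HB))) (ketBraSum e c d f) :=
  Summable.hasSum f.2

theorem mem_domain_leftMul (q : ℍ) (f : HB) : f ∈ (leftMul q).domain := by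
  refine summable_ket ?_
  simp only [norm_mul, mul_pow]
  exact (coords.parseval f).summable.mul_left _

theorem mem_domain_opMul_iff {A B : HB →ₗ.[ℍᵐᵒᵖ] HB} {f : HB} :
    f ∈ (opMul B A).domain ↔ ∃ hf : f ∈ A.domain, A ⟨f, hf⟩ ∈ B.domain := by
  constructor
  · rintro ⟨y, hy, rfl⟩
    exact ⟨y.2, hy⟩
  · rintro ⟨hf, h⟩
    exact ⟨⟨f, hf⟩, h, rfl⟩

theorem opMul_apply {A B : HB →ₗ.[ℍᵐᵒᵖ] HB} {f : HB} (hf : f ∈ A.domain)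
    (h : A ⟨f, hf⟩ ∈ B.domain) (h' : f ∈ (opMul B A).domain) :
    opMul B A ⟨f, h'⟩ = B ⟨A ⟨f, hf⟩, h⟩ := rfl

/-- Rewrites left multiplication after a raising operator as the series required by
`Coordinates.closure_mem_of_tendsto`. The first `d` terms vanish, which permits the shift of index.
-/
theorem tendsto_raise {f x : HB} {d : ℕ} {β : ℕ → ℝ}
    (h1 : ∀ k, coords.coeff (k + d) x = β k • coords.coeff k f)
    (h2 : ∀ k < d, coords.coeff k x = 0) (p : ℍ) (r : ℝ) :
    Tendsto (fun n => ∑ k ∈ Finset.range n,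
      coords.ket (k + d) ((r * β k) • (p * coords.coeff k f))) atTop
      (𝓝 (r • leftMul p ⟨x, mem_domain_leftMul p x⟩)) := by
  have h3 := (((tendsto_add_atTop_iff_nat d).2 (hasSum_ketBraSum (e := Φ) (c := fun _ => p) (d := Φ)
    ⟨x, mem_domain_leftMul p x⟩).tendsto_sum_nat)).const_smul r
  refine h3.congr fun n => ?_
  rw [add_comm n d, Finset.sum_range_add, Finset.sum_eq_zero, zero_add, Finset.smul_sum]
  · refine Finset.sum_congr rfl fun k _ => ?_
    rw [add_comm d k, ← coeff_coords, h1, ← ket_coords, mul_smul_comm, mul_smul, map_smul _ r]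
  · intro k hk
    rw [← coeff_coords, h2 k (Finset.mem_range.1 hk), mul_zero, MulOpposite.op_zero, zero_smul]

theorem tendsto_lower {f y : HB} {d : ℕ} {β : ℕ → ℝ}
    (h1 : ∀ k, coords.coeff k y = β k • coords.coeff (k + d) f) (p : ℍ) (r : ℝ) :
    Tendsto (fun n => ∑ k ∈ Finset.range n,
      coords.ket k ((r * β k) • (p * coords.coeff (k + d) f))) atTop
      (𝓝 (r • leftMul p ⟨y, mem_domain_leftMul p y⟩)) := by
  have h3 := (hasSum_ketBraSum (e := Φ) (c := fun _ => p) (d := Φ)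
    ⟨y, mem_domain_leftMul p y⟩).tendsto_sum_nat.const_smul r
  refine h3.congr fun n => ?_
  rw [Finset.smul_sum]
  refine Finset.sum_congr rfl fun k _ => ?_
  rw [← coeff_coords, h1, ← ket_coords, mul_smul_comm, mul_smul, map_smul _ r]

/-- The closure of `r (p · X - p̄ · Y)` for a raising operator `X` and a lowering operator `Y`. -/
theorem closure_graph_eq {X Y : HB →ₗ.[ℍᵐᵒᵖ] HB} {d : ℕ} {β : ℕ → ℝ}
    (hX : ∀ f : X.domain, (∀ k, coords.coeff (k + d) (X f) = β k • coords.coeff k (f : HB)) ∧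
      ∀ k < d, coords.coeff k (X f) = 0)
    (hY : ∀ (f : Y.domain) (k : ℕ), coords.coeff k (Y f) = β k • coords.coeff (k + d) (f : HB))
    (hXd : ∀ f ∈ coords.finiteVectors, f ∈ X.domain)
    (hYd : ∀ f ∈ coords.finiteVectors, f ∈ Y.domain) (p : ℍ) (r : ℝ) :
    closure ((r • (opMul (leftMul p) X - opMul (leftMul (star p)) Y)).graph : Set (HB × HB)) =
      (eventualGraph (coords.ladder d (fun k => r * β k) p)
        coords.finiteVectors).topologicalClosure := by
  set A := r • (opMul (leftMul p) X - opMul (leftMul (star p)) Y) with hA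
  have hval : ∀ (f : HB) (hf : f ∈ A.domain) (hfX : f ∈ X.domain) (hfY : f ∈ Y.domain),
      A ⟨f, hf⟩ = r • leftMul p ⟨X ⟨f, hfX⟩, mem_domain_leftMul p _⟩ -
        r • leftMul (star p) ⟨Y ⟨f, hfY⟩, mem_domain_leftMul (star p) _⟩ := by
    intro f hf hfX hfY
    rw [← smul_sub]
    rfl
  refine Set.Subset.antisymm (closure_minimal ?_
    (eventualGraph _ coords.finiteVectors).isClosed_topologicalClosure) (closure_mono ?_)
  · intro x hx
    obtain ⟨⟨f, hf⟩, hf1, hf2⟩ := (LinearPMap.mem_graph_iff _).1 hx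
    have hfd : f ∈ (opMul (leftMul p) X).domain ∧ f ∈ (opMul (leftMul (star p)) Y).domain := hf
    obtain ⟨hfX, -⟩ := mem_domain_opMul_iff.1 hfd.1
    obtain ⟨hfY, -⟩ := mem_domain_opMul_iff.1 hfd.2
    have h := coords.closure_mem_of_tendsto d (fun k => r * β k) p
      (tendsto_raise (hX ⟨f, hfX⟩).1 (hX ⟨f, hfX⟩).2 p r)
      (tendsto_lower (hY ⟨f, hfY⟩) (star p) r)
    rw [← hval f hf hfX hfY, hf2] at h
    have hx' : x = (f, x.2) := Prod.ext hf1.symm rfl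
    rw [hx']
    exact h
  -- Conversely, finite vectors lie in the natural domain, and on them the series are eventually
  -- constant with the ladder's value.
  · rintro x ⟨hx1, hx2⟩
    have hfX := hXd _ hx1
    have hfY := hYd _ hx1
    have hf : x.1 ∈ A.domain :=
      ⟨mem_domain_opMul_iff.2 ⟨hfX, mem_domain_leftMul p _⟩,
        mem_domain_opMul_iff.2 ⟨hfY, mem_domain_leftMul (star p) _⟩⟩
    refine (LinearPMap.mem_graph_iff _).2 ⟨⟨x.1, hf⟩, rfl, ?_⟩
    have h1 := (tendsto_raise (hX ⟨x.1, hfX⟩).1 (hX ⟨x.1, hfX⟩).2 p r).sub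
      (tendsto_lower (hY ⟨x.1, hfY⟩) (star p) r)
    rw [← hval x.1 hf hfX hfY] at h1
    refine tendsto_nhds_unique h1 (tendsto_const_nhds.congr' ?_)
    filter_upwards [hx2] with n hn
    rw [← hn, Coordinates.ladder_apply, ← Finset.sum_sub_distrib]
    refine Finset.sum_congr rfl fun k _ => ?_
    rw [map_smul, map_smul, smul_sub]

theorem coeff_creat (f : creat.domain) :
    (∀ k, coords.coeff (k + 1) (creat f) = √(k + 1 : ℝ) • coords.coeff k (f : HB)) ∧
      ∀ k < 1, coords.coeff k (creat f) = 0 := by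
  have h := fun j => (hasSum_ketBraSum (e := fun n => Φ (n + 1)) f).mapL (coords.coeff j)
  simp only [← ket_coords, coords.coeff_ket] at h
  refine ⟨fun k => ?_, fun k hk => ?_⟩
  · refine (h (k + 1)).unique ?_
    convert hasSum_ite_eq k (√(k + 1 : ℝ) • coords.coeff k (f : HB)) using 2 with n
    by_cases hn : n = k
    · subst hn
      rw [if_pos rfl, if_pos rfl, Quaternion.coe_mul_eq_smul, coeff_coords]
    · rw [if_neg hn, if_neg (by omega)]
  · refine (h k).unique ?_
    convert hasSum_zero with n
    rw [if_neg (by omega)]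

theorem coeff_annih (f : annih.domain) (k : ℕ) :
    coords.coeff k (annih f) = √(k + 1 : ℝ) • coords.coeff (k + 1) (f : HB) := by
  have h := (hasSum_ketBraSum (d := fun n => Φ (n + 1)) f).mapL (coords.coeff k)
  simp only [← ket_coords, coords.coeff_ket] at h
  refine h.unique ?_
  convert hasSum_ite_eq k (√(k + 1 : ℝ) • coords.coeff (k + 1) (f : HB)) using 2 with n
  by_cases hn : n = k
  · subst hn
    rw [if_pos rfl, if_pos rfl, Quaternion.coe_mul_eq_smul, coeff_coords]
  · rw [if_neg hn, if_neg (Ne.symm hn)]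

theorem mem_domain_creat {f : HB} (hf : f ∈ coords.finiteVectors) : f ∈ creat.domain := by
  obtain ⟨N, hN⟩ := hf
  refine summable_of_ne_finset_zero (s := Finset.range N) fun n hn => ?_
  rw [← coeff_coords, hN n (by simpa using hn), mul_zero, MulOpposite.op_zero, zero_smul]

theorem mem_domain_annih {f : HB} (hf : f ∈ coords.finiteVectors) : f ∈ annih.domain := by
  obtain ⟨N, hN⟩ := hf
  refine summable_of_ne_finset_zero (s := Finset.range N) fun n hn => ?_
  have hn' : N ≤ n := by simpa using hn
  rw [← coeff_coords, hN (n + 1) (by omega), mul_zero, MulOpposite.op_zero, zero_smul]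

theorem closure_graph_displacementExponent (q : ℍ) :
    closure ((displacementExponent q).graph : Set (HB × HB)) =
      (eventualGraph (coords.ladder 1 (fun k => 1 * √(k + 1 : ℝ)) q)
        coords.finiteVectors).topologicalClosure := by
  rw [← closure_graph_eq (X := creat) (Y := annih) coeff_creat coeff_annih
    (fun _ => mem_domain_creat) (fun _ => mem_domain_annih) q 1, one_smul]
  rfl

theorem closure_graph_squeezeExponent (p : ℍ) :
    closure ((squeezeExponent p).graph : Set (HB × HB)) =
      (eventualGraph (coords.ladder 2 (fun k => 1 / 2 * (√(k + 2 : ℝ) * √(k + 1 : ℝ))) p)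
        coords.finiteVectors).topologicalClosure := by
  refine closure_graph_eq (X := opMul creat creat) (Y := opMul annih annih) ?_ ?_ ?_ ?_ p (1 / 2)
  · rintro ⟨f, hf⟩
    obtain ⟨h1, h2⟩ := mem_domain_opMul_iff.1 hf
    rw [opMul_apply h1 h2]
    obtain ⟨h3, h4⟩ := coeff_creat ⟨f, h1⟩
    obtain ⟨h5, h6⟩ := coeff_creat ⟨_, h2⟩
    refine ⟨fun k => ?_, fun k hk => ?_⟩
    · rw [← add_assoc k 1 1, h5 (k + 1)]
      simp only [h3, smul_smul]
      push_cast
      ring_nf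
    · obtain rfl | rfl : k = 0 ∨ k = 0 + 1 := by omega
      · exact h6 0 one_pos
      · rw [h5 0]
        simp only [h4 0 one_pos, smul_zero]
  · rintro ⟨f, hf⟩ k
    obtain ⟨h1, h2⟩ := mem_domain_opMul_iff.1 hf
    rw [opMul_apply h1 h2, coeff_annih]
    simp only [coeff_annih, smul_smul]
    push_cast
    -- Two lowering steps produce the root factors in the opposite order to two raising steps.
    rw [mul_comm, add_assoc k 1 1, add_assoc (k : ℝ) 1 1, one_add_one_eq_two]
  · intro f hf
    refine mem_domain_opMul_iff.2 ⟨mem_domain_creat hf, mem_domain_creat ?_⟩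
    obtain ⟨N, hN⟩ := hf
    refine ⟨N + 1, fun k hk => ?_⟩
    obtain ⟨j, rfl⟩ := Nat.exists_eq_add_of_le' (show 1 ≤ k by omega)
    rw [(coeff_creat _).1 j]
    simp only [hN j (by omega), smul_zero]
  · intro f hf
    refine mem_domain_opMul_iff.2 ⟨mem_domain_annih hf, mem_domain_annih ?_⟩
    obtain ⟨N, hN⟩ := hf
    refine ⟨N, fun k hk => ?_⟩
    rw [coeff_annih]
    simp only [hN (k + 1) (by omega), smul_zero]

end Graphs

/-! ### Existence, uniqueness and unitarity of the exponentials -/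

section Exponentials

/-- Right multiplication by a quaternion, as a real linear map. -/
def rightMul (q : ℍ) : HB →L[ℝ] HB where
  toFun f := f <• q
  map_add' := smul_add _
  map_smul' r f := smul_comm _ r f
  cont := continuous_const_smul (MulOpposite.op q)

theorem rightMul_apply (q : ℍ) (f : HB) : rightMul q f = f <• q := rfl

/-- The ladder acts on coordinates by left multiplication, so associativity lets right scalars pass;
this makes the limit group right linear. -/
theorem rightMul_ladder (d : ℕ) (α : ℕ → ℝ) (p q : ℍ) (n : ℕ) (f : HB) :
    rightMul q (coords.ladder d α p n f) = coords.ladder d α p n (rightMul q f) := by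
  have h1 : ∀ k h, rightMul q (coords.ket k h) = coords.ket k (h * q) := by
    intro k h
    rw [rightMul_apply, ket_coords, ket_coords, MulOpposite.op_mul, mul_smul]
  have h2 : ∀ k, coords.coeff k (rightMul q f) = coords.coeff k f * q := fun k =>
    qinner_smul_right _ f q
  simp only [Coordinates.ladder_apply, map_sum, map_smul, map_sub, h1, h2, mul_assoc]

/-- The properties of the one-parameter group generated by the closure of an operator. -/
structure IsGeneratedGroup (A : HB →ₗ.[ℍᵐᵒᵖ] HB) (U : ℝ → HB →L[ℝ] HB) : Prop where
  zero : ∀ f, U 0 f = f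
  add : ∀ s t f, U (s + t) f = U s (U t f)
  norm_map : ∀ t f, ‖U t f‖ = ‖f‖
  continuous : ∀ f, Continuous fun t => U t f
  hasDerivAt : ∀ x ∈ closure (A.graph : Set (HB × HB)), HasDerivAt (fun t => U t x.1) x.2 0
  isOperatorExp : IsOperatorExp A (operatorExp A)
  operatorExp_eq : ∀ f, operatorExp A f = U 1 f

theorem exists_isGeneratedGroup {A : HB →ₗ.[ℍᵐᵒᵖ] HB} {d : ℕ} {α : ℕ → ℝ} {p : ℍ} {C : ℝ}
    (hα : ∀ k, |α k| ≤ C * (k + 1))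
    (hA : closure (A.graph : Set (HB × HB)) =
      (eventualGraph (coords.ladder d α p) coords.finiteVectors).topologicalClosure) :
    ∃ U, IsGeneratedGroup A U := by
  have happ := coords.isFlowApprox p hα (d := d)
  have hlin : ∀ t (q : ℍᵐᵒᵖ) f, happ.limit t (q • f) = q • happ.limit t f := fun t q f =>
    (happ.commute_limit (B := rightMul q.unop) (rightMul_ladder d α p q.unop) t f).symm
  let U : ℝ → HB →L[ℍᵐᵒᵖ] HB := fun t =>
    { toFun := happ.limit t
      map_add' := map_add _
      map_smul' := hlin t
      cont := (happ.limit t).continuous }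
  have hU : ∀ t f, U t f = happ.limit t f := fun t f => rfl
  have hderiv : ∀ x ∈ closure (A.graph : Set (HB × HB)),
      HasDerivAt (fun t => happ.limit t x.1) x.2 0 := by
    intro x hx
    rw [hA] at hx
    exact happ.hasDerivAt_limit hx
  have hex : ∃ S, IsOperatorExp A S := by
    refine ⟨U 1, U, ?_, fun s t => ?_, happ.continuous_limit, fun f g => ?_, rfl⟩
    · ext1 f
      exact happ.limit_zero f
    · ext1 f
      exact happ.limit_add s t f
    · rw [hA]
      exact happ.hasDerivAt_limit_iff f g
  have hspec : IsOperatorExp A (operatorExp A) := by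
    rw [operatorExp, dif_pos hex]
    exact hex.choose_spec
  refine ⟨happ.limit, happ.limit_zero, happ.limit_add, happ.norm_limit, happ.continuous_limit,
    hderiv, hspec, ?_⟩
  obtain ⟨V, hV0, hVadd, hVc, hVgen, hV1⟩ := hspec
  have hVadd' : ∀ s t f, V (s + t) f = V s (V t f) := fun s t f => by
    rw [hVadd]
    rfl
  -- The exponential is an arbitrary choice among admissible operators. The group `V` behind it has
  -- the same generator, so its orbits of finite vectors coincide with those of the limit group;
  -- density does the rest.
  have hD : ∀ f ∈ coords.finiteVectors, operatorExp A f = happ.limit 1 f := by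
    intro f hf
    obtain ⟨g, hg⟩ := happ.eventually_eq f hf
    have hfg : (f, g) ∈ closure (A.graph : Set (HB × HB)) := by
      rw [hA]
      exact Submodule.le_topologicalClosure _ ⟨hf, hg⟩
    have h0 := (hVgen f g).2 hfg
    have hpush : ∀ t, HasDerivAt (fun s => V t (V s f)) (V t g) 0 := fun t =>
      ({ V t with
          map_smul' := fun (r : ℝ) f => by
            have h := (V t).map_smul (algebraMap ℝ ℍᵐᵒᵖ r) f
            rw [algebraMap_smul, algebraMap_smul] at h
            exact h } : HB →L[ℝ] HB).hasFDerivAt.comp_hasDerivAt 0 h0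
    have h1 : ∀ t, HasDerivAt (fun s => V s f) (V t g) t := by
      intro t
      have h2 := hpush t
      rw [← sub_self t] at h2
      have h3 := h2.comp_sub_const t t
      refine h3.congr_of_eventuallyEq (Eventually.of_forall fun s => ?_)
      simp only
      rw [← hVadd', add_sub_cancel]
    -- The operators `V s` and `V t` commute, so the closed graph is invariant under `V t`.
    have h2 : ∀ t, (V t f, V t g) ∈ closure (A.graph : Set (HB × HB)) := by
      intro t
      refine (hVgen _ _).1 ((hpush t).congr_of_eventuallyEq (Eventually.of_forall fun s => ?_))
      simp only
      rw [← hVadd', ← hVadd', add_comm]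
    have h3 := orbit_eq_of_hasDerivAt happ.limit_zero happ.limit_add happ.norm_limit
      happ.continuous_limit hderiv h1 h2 1
    rw [hV0] at h3
    rw [← hV1]
    exact h3
  exact fun f => congrFun (Continuous.ext_on happ.dense (operatorExp A).continuous
    (happ.limit 1).continuous hD) f

theorem IsGeneratedGroup.isUnitary {A : HB →ₗ.[ℍᵐᵒᵖ] HB} {U : ℝ → HB →L[ℝ] HB}
    (hU : IsGeneratedGroup A U) : IsUnitary (operatorExp A) := by
  refine ⟨qinner_map_map fun f => ?_, fun f => ⟨U (-1) f, ?_⟩⟩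
  · rw [hU.operatorExp_eq, hU.norm_map]
  · rw [hU.operatorExp_eq, ← hU.add, add_neg_cancel, hU.zero]

theorem sqrt_add_one_le (k : ℕ) : √(k + 1 : ℝ) ≤ k + 1 := by
  rw [Real.sqrt_le_left (by positivity)]
  nlinarith [(k.cast_nonneg : (0 : ℝ) ≤ k)]

theorem exists_displacement_group (q : ℍ) : ∃ U, IsGeneratedGroup (displacementExponent q) U := by
  refine exists_isGeneratedGroup (C := 1) (fun k => ?_) (closure_graph_displacementExponent q)
  rw [one_mul, one_mul, abs_of_nonneg (Real.sqrt_nonneg _)]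
  exact sqrt_add_one_le k

/-- The squeeze coefficients are half of `√((k + 2) * (k + 1))`, at most `k + 1`: the growth is
still linear, just what the weighted estimate needs. -/
theorem exists_squeeze_group (p : ℍ) : ∃ U, IsGeneratedGroup (squeezeExponent p) U := by
  refine exists_isGeneratedGroup (C := 1) (fun k => ?_) (closure_graph_squeezeExponent p)
  rw [abs_of_nonneg (by positivity), ← Real.sqrt_mul (by positivity), one_mul]
  have h : √((k + 2 : ℝ) * (k + 1)) ≤ 2 * (k + 1) := by
    rw [Real.sqrt_le_left (by positivity)]
    nlinarith [(k.cast_nonneg : (0 : ℝ) ≤ k)]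
  linarith

end Exponentials

/-! ### Coherent states -/

section Coherent

/-- The coefficient vectors of the coherent states. -/
def coherentTerm (q : ℍ) (n : ℕ) : HB := coords.ket n ((1 / √(n.factorial : ℝ) : ℝ) • q ^ n)

theorem norm_coherentTerm (q : ℍ) (n : ℕ) :
    ‖coherentTerm q n‖ = ‖q‖ ^ n / √(n.factorial : ℝ) := by
  rw [coherentTerm, coords.norm_ket, norm_smul, norm_pow, Real.norm_of_nonneg (by positivity)]
  ring

theorem summable_coherentTerm (q : ℍ) : Summable (coherentTerm q) :=
  Summable.of_norm_bounded (summable_pow_div_sqrt_factorial ‖q‖)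
    fun n => (norm_coherentTerm q n).le

theorem coherentTerm_smul (q : ℍ) (t : ℝ) (n : ℕ) :
    coherentTerm (t • q) n = t ^ n • coherentTerm q n := by
  rw [coherentTerm, coherentTerm, ← map_smul, smul_pow, smul_comm]

theorem coherentState_eq (q : ℍ) :
    coherentState q = Real.exp (-‖q‖ ^ 2 / 2) • ∑' n, coherentTerm q n := rfl

theorem coherentState_zero : coherentState 0 = Φ 0 := by
  rw [coherentState_eq, tsum_eq_single 0]
  · simp [coherentTerm, ket_coords]
  · intro n hn
    simp [coherentTerm, zero_pow hn]

theorem coeff_coherentState (q : ℍ) (k : ℕ) : coords.coeff k (coherentState q) =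
    (Real.exp (-‖q‖ ^ 2 / 2) * (1 / √(k.factorial : ℝ))) • q ^ k := by
  rw [coherentState_eq, map_smul, (coords.coeff k).map_tsum (summable_coherentTerm q),
    tsum_eq_single k]
  · rw [coherentTerm, coords.coeff_ket, if_pos rfl, mul_smul]
  · intro n hn
    rw [coherentTerm, coords.coeff_ket, if_neg (Ne.symm hn)]

theorem summable_deriv_coherentTerm (q : ℍ) (R : ℝ) :
    Summable fun n : ℕ => n * R ^ (n - 1) * ‖coherentTerm q n‖ := by
  refine Summable.of_norm_bounded
    (summable_pow_div_sqrt_factorial (2 * ((|R| + 1) * ‖q‖))) fun n => ?_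
  rw [norm_mul, norm_mul, norm_norm, norm_coherentTerm, norm_pow, Real.norm_natCast,
    Real.norm_eq_abs, mul_pow, mul_pow]
  -- The factor `n` from differentiation is absorbed by doubling the radius.
  have h1 : (n : ℝ) ≤ 2 ^ n := by exact_mod_cast n.lt_two_pow_self.le
  have h2 : |R| ^ (n - 1) ≤ (|R| + 1) ^ n :=
    (pow_le_pow_left₀ (abs_nonneg R) (by linarith) _).trans
      (pow_le_pow_right₀ (by linarith [abs_nonneg R]) (Nat.sub_le n 1))
  calc _ ≤ 2 ^ n * (|R| + 1) ^ n * (‖q‖ ^ n / √(n.factorial : ℝ)) := by gcongr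
    _ = _ := by ring

theorem hasDerivAt_tsum_coherentTerm (q : ℍ) (t : ℝ) :
    HasDerivAt (fun t : ℝ => ∑' n, coherentTerm (t • q) n)
      (∑' n : ℕ, (n * t ^ (n - 1)) • coherentTerm q n) t := by
  simp only [coherentTerm_smul]
  refine hasDerivAt_tsum_of_isPreconnected (summable_deriv_coherentTerm q (|t| + 1))
    (t := Metric.ball 0 (|t| + 1)) Metric.isOpen_ball (convex_ball _ _).isPreconnected
    (fun n s _ => (hasDerivAt_pow n s).smul_const _) (fun n s hs => ?_)
    (y₀ := t) (by simp) ?_ (by simp)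
  · rw [norm_smul, norm_mul, norm_pow, Real.norm_natCast]
    gcongr
    exact (mem_ball_zero_iff.1 hs).le
  · exact (summable_coherentTerm (t • q)).congr fun n => coherentTerm_smul q t n

theorem hasDerivAt_coherentState (q : ℍ) (t : ℝ) :
    HasDerivAt (fun t : ℝ => coherentState (t • q))
      (Real.exp (-‖t • q‖ ^ 2 / 2) • (∑' n : ℕ, (n * t ^ (n - 1)) • coherentTerm q n) -
        (t * ‖q‖ ^ 2) • coherentState (t • q)) t := by
  have h1 : HasDerivAt (fun t : ℝ => Real.exp (-‖t • q‖ ^ 2 / 2))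
      (-(t * ‖q‖ ^ 2) * Real.exp (-‖t • q‖ ^ 2 / 2)) t := by
    have h2 : ∀ t : ℝ, -‖t • q‖ ^ 2 / 2 = (-‖q‖ ^ 2 / 2) * t ^ 2 := by
      intro t
      rw [norm_smul, mul_pow, Real.norm_eq_abs, sq_abs]
      ring
    simp only [h2]
    refine (((hasDerivAt_pow 2 t).const_mul (-‖q‖ ^ 2 / 2)).exp).congr_deriv ?_
    simp
    ring
  refine (h1.fun_smul (hasDerivAt_tsum_coherentTerm q t)).congr_deriv ?_
  rw [coherentState_eq, smul_smul, neg_mul, neg_smul, sub_eq_add_neg]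

/-- The velocity splits into the two halves of the exponent. Differentiating the powers of `t` gives
the creation half; the Gaussian factor gives the annihilation half, because `star q * q ^ (k + 1) =
‖q‖ ^ 2 • q ^ k`. -/
theorem deriv_coherentState_mem (q : ℍ) (t : ℝ) :
    (coherentState (t • q), Real.exp (-‖t • q‖ ^ 2 / 2) •
      (∑' n : ℕ, (n * t ^ (n - 1)) • coherentTerm q n) - (t * ‖q‖ ^ 2) • coherentState (t • q)) ∈
      closure ((displacementExponent q).graph : Set (HB × HB)) := by
  rw [closure_graph_displacementExponent]
  set E := Real.exp (-‖t • q‖ ^ 2 / 2) with hE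
  have hfac : ∀ k : ℕ, √((k + 1).factorial : ℝ) = √(k + 1 : ℝ) * √(k.factorial : ℝ) := by
    intro k
    rw [Nat.factorial_succ, Nat.cast_mul, Real.sqrt_mul (by positivity)]
    push_cast
    rfl
  have hpos : ∀ k : ℕ, √(k.factorial : ℝ) ≠ 0 := fun k => (Real.sqrt_pos.2 (by positivity)).ne'
  have hpos' : ∀ k : ℕ, √(k + 1 : ℝ) ≠ 0 := fun k => (Real.sqrt_pos.2 (by positivity)).ne'
  refine coords.closure_mem_of_tendsto 1 (fun k => 1 * √(k + 1 : ℝ)) q ?_ ?_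
  · have h1 : Summable fun n : ℕ => (n * t ^ (n - 1)) • coherentTerm q n := by
      refine Summable.of_norm_bounded (summable_deriv_coherentTerm q |t|) fun n => ?_
      rw [norm_smul, norm_mul, norm_pow, Real.norm_natCast, Real.norm_eq_abs]
    have h2 := ((tendsto_add_atTop_iff_nat 1).2 h1.hasSum.tendsto_sum_nat).const_smul E
    refine h2.congr fun n => ?_
    -- The term `n = 0` of the differentiated series vanishes, so its index shifts to match raising
    -- from `k` to `k + 1`.
    rw [Finset.sum_range_succ', Nat.cast_zero, zero_mul, zero_smul, add_zero, Finset.smul_sum]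
    refine Finset.sum_congr rfl fun k _ => ?_
    rw [coeff_coherentState, ← hE, coherentTerm, ← map_smul, ← map_smul, smul_pow, hfac]
    congr 1
    rw [mul_smul_comm, mul_smul_comm, ← pow_succ', smul_smul, smul_smul, smul_smul, smul_smul]
    congr 1
    have h3 : √(k + 1 : ℝ) * √(k + 1 : ℝ) = k + 1 := Real.mul_self_sqrt (by positivity)
    have := hpos k
    have := hpos' k
    push_cast
    generalize √(k + 1 : ℝ) = s at *
    rw [← h3]
    field_simp
  · have h2 := (((summable_coherentTerm (t • q)).hasSum.tendsto_sum_nat).const_smul E).const_smul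
      (t * ‖q‖ ^ 2)
    refine h2.congr fun n => ?_
    rw [Finset.smul_sum, Finset.smul_sum]
    refine Finset.sum_congr rfl fun k _ => ?_
    rw [coeff_coherentState, ← hE, coherentTerm, ← map_smul, ← map_smul, hfac]
    congr 1
    have h3 : star q * q ^ (k + 1) = ‖q‖ ^ 2 • q ^ k := by
      rw [pow_succ', ← mul_assoc, Quaternion.star_mul_self, Quaternion.coe_mul_eq_smul,
        Quaternion.normSq_eq_norm_mul_self, sq]
    rw [smul_pow, smul_pow, mul_smul_comm, mul_smul_comm, h3]
    simp only [smul_smul]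
    congr 1
    have := hpos k
    have := hpos' k
    field_simp
    ring

theorem displacement_vacuum (q : ℍ) : displacement q (Φ 0) = coherentState q := by
  obtain ⟨U, hU⟩ := exists_displacement_group q
  have h := orbit_eq_of_hasDerivAt hU.zero hU.add hU.norm_map hU.continuous hU.hasDerivAt
    (hasDerivAt_coherentState q) (deriv_coherentState_mem q) 1
  rw [one_smul, zero_smul, coherentState_zero] at h
  rw [h, displacement, hU.operatorExp_eq]

/-- The scalar product with a fixed vector as a real linear map. -/
def qinnerMap (f : HB) : HB →L[ℝ] ℍ :=
  LinearMap.mkContinuous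
    { toFun := qinner f
      map_add' := qinner_add f
      map_smul' := fun r g => by
        rw [← algebraMap_smul ℍᵐᵒᵖ r g]
        refine (qinner_smul f g _).trans ?_
        exact Quaternion.mul_coe_eq_smul r _ }
    ‖(f : L2)‖ (fun g => norm_pairing_le (f : L2) (g : L2))

theorem qinnerMap_apply (f g : HB) : qinnerMap f g = qinner f g := rfl

/-- The scalar product with a coherent state is a weighted point evaluation. -/
theorem qinner_coherentState (q : ℍ) (f : HB) : qinner (coherentState q) f =
    Real.exp (-‖q‖ ^ 2 / 2) •
      ∑' n, (star q) ^ n * ((1 / √(n.factorial : ℝ) : ℝ) • qinner (Φ n) f) := by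
  have hs := ((summable_coherentTerm q).hasSum.mapL (qinnerMap f)).mapL starMap
  rw [coherentState_eq, ← star_qinner, ← qinnerMap_apply, map_smul, Quaternion.star_smul,
    ← starMap_apply, ← hs.tsum_eq]
  congr 1
  refine tsum_congr fun n => ?_
  rw [starMap_apply, qinnerMap_apply, star_qinner, coherentTerm, ket_coords, smul_qinner,
    Quaternion.star_smul, star_pow, smul_mul_assoc, mul_smul_comm]

theorem qinner_mul_qinner_coherentState (q : ℍ) (f g : HB) :
    qinner f (coherentState q) * qinner (coherentState q) g = Real.exp (-‖q‖ ^ 2) •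
      (star (∑' n, (star q) ^ n * ((1 / √(n.factorial : ℝ) : ℝ) • qinner (Φ n) f)) *
        ∑' n, (star q) ^ n * ((1 / √(n.factorial : ℝ) : ℝ) • qinner (Φ n) g)) := by
  rw [← star_qinner, qinner_coherentState, qinner_coherentState, Quaternion.star_smul,
    smul_mul_smul_comm, ← Real.exp_add]
  congr 2
  ring

/-- The Gaussian factor of the two pairings converts `flatMeasure` into `gaussMeasure`. What remains
is the integrand of `qinner f g` at `star q`, and conjugation preserves the measure. -/
theorem resolution_coherentState (f g : HB) :
    Integrable (fun q => qinner f (coherentState q) * qinner (coherentState q) g) flatMeasure ∧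
      ∫ q, qinner f (coherentState q) * qinner (coherentState q) g ∂flatMeasure = qinner f g := by
  set H : ℍ → ℍ := fun x => star (∑' n, x ^ n * ((1 / √(n.factorial : ℝ) : ℝ) • qinner (Φ n) f)) *
        ∑' n, x ^ n * ((1 / √(n.factorial : ℝ) : ℝ) • qinner (Φ n) g) with hH
  have hae : (fun x => star ((f : L2) x) * (g : L2) x) =ᵐ[gaussMeasure] H := by
    filter_upwards [ae_eq_tsum f, ae_eq_tsum g] with x h1 h2
    rw [h1, h2]
  have hstar : MeasurePreserving (star : ℍ → ℍ) gaussMeasure gaussMeasure :=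
    measurePreserving_star _ (by fun_prop)
  have hint : Integrable H gaussMeasure := (integrable_qinner f g).congr hae
  have hint' : Integrable (fun q => H (star q)) gaussMeasure :=
    hstar.integrable_comp_of_integrable hint
  have hval : ∫ q, H (star q) ∂gaussMeasure = qinner f g := by
    rw [qinner, integral_congr_ae hae]
    have h := integral_map (μ := gaussMeasure) hstar.measurable.aemeasurable (f := H)
      (by rw [hstar.map_eq]; exact hint.aestronglyMeasurable)
    rw [← h, hstar.map_eq]
  have hw : Measurable fun q : ℍ => ENNReal.ofReal (Real.exp (-‖q‖ ^ 2)) := by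
    have h : Continuous fun q : ℍ => Real.exp (-‖q‖ ^ 2) := by fun_prop
    exact h.measurable.ennreal_ofReal
  have hfin : ∀ᵐ q : ℍ ∂flatMeasure, ENNReal.ofReal (Real.exp (-‖q‖ ^ 2)) < ⊤ :=
    Eventually.of_forall fun q => ENNReal.ofReal_lt_top
  have heq : (fun q => qinner f (coherentState q) * qinner (coherentState q) g) =
      fun q => (ENNReal.ofReal (Real.exp (-‖q‖ ^ 2))).toReal • H (star q) := by
    funext q
    rw [qinner_mul_qinner_coherentState, ENNReal.toReal_ofReal (Real.exp_pos _).le]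
  rw [heq]
  constructor
  · rw [gaussMeasure_eq_withDensity] at hint'
    exact (integrable_withDensity_iff_integrable_smul' hw hfin).1 hint'
  · rw [← integral_withDensity_eq_integral_toReal_smul hw hfin, ← gaussMeasure_eq_withDensity, hval]

end Coherent

end QBargmann

end

/-! ### Unitarity, normalization and resolution of the identity -/

theorem mainTheorem4 :
    -- the displacement and squeeze operators exist and are unitary
    (∀ q : ℍ, QBargmann.IsOperatorExp (QBargmann.displacementExponent q)
        (QBargmann.displacement q) ∧ QBargmann.IsUnitary (QBargmann.displacement q)) ∧
    (∀ p : ℍ, QBargmann.IsOperatorExp (QBargmann.squeezeExponent p) (QBargmann.squeeze p) ∧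
        QBargmann.IsUnitary (QBargmann.squeeze p)) ∧
    -- the two forms of the squeezed states agree
    (∀ p q : ℍ, QBargmann.squeezedState p q =
        QBargmann.squeeze p (QBargmann.coherentState q)) ∧
    -- normalization
    (∀ p q : ℍ,
      QBargmann.qinner (QBargmann.squeezedState p q) (QBargmann.squeezedState p q) = 1) ∧
    -- resolution of the identity, in the weak sense
    (∀ (p : ℍ) (f g : QBargmann.HB),
      Integrable (fun q => QBargmann.qinner f (QBargmann.squeezedState p q) *
        QBargmann.qinner (QBargmann.squeezedState p q) g) QBargmann.flatMeasure ∧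
      ∫ q, QBargmann.qinner f (QBargmann.squeezedState p q) *
        QBargmann.qinner (QBargmann.squeezedState p q) g ∂QBargmann.flatMeasure =
        QBargmann.qinner f g) := by
  have hD : ∀ q, QBargmann.IsOperatorExp (QBargmann.displacementExponent q)
      (QBargmann.displacement q) ∧ QBargmann.IsUnitary (QBargmann.displacement q) := by
    intro q
    obtain ⟨U, hU⟩ := QBargmann.exists_displacement_group q
    exact ⟨hU.isOperatorExp, hU.isUnitary⟩
  have hS : ∀ p, QBargmann.IsOperatorExp (QBargmann.squeezeExponent p) (QBargmann.squeeze p) ∧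
      QBargmann.IsUnitary (QBargmann.squeeze p) := by
    intro p
    obtain ⟨U, hU⟩ := QBargmann.exists_squeeze_group p
    exact ⟨hU.isOperatorExp, hU.isUnitary⟩
  have hsq : ∀ p q, QBargmann.squeezedState p q =
      QBargmann.squeeze p (QBargmann.coherentState q) := by
    intro p q
    rw [QBargmann.squeezedState, QBargmann.displacement_vacuum]
  refine ⟨hD, hS, hsq, fun p q => ?_, fun p f g => ?_⟩
  · rw [QBargmann.squeezedState, (hS p).2.1, (hD q).2.1, QBargmann.qinner_basis, if_pos rfl]
  -- Surjectivity of the squeeze operator lets both vectors be written as images. Unitarity then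
  -- removes it from every scalar product and leaves the case of coherent states.
  · obtain ⟨f, rfl⟩ := (hS p).2.2 f
    obtain ⟨g, rfl⟩ := (hS p).2.2 g
    simp only [hsq, (hS p).2.1]
    exact QBargmann.resolution_coherentState f g
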